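/- Let $f:\mathbb R^n\to\mathbb R$ be convex and twice differentiable, with gradient $g$ and Hessian $G$, and suppose that (i) $G(x)\preceq MI$ on the level set $\{x: f(x)\le f(x_1^{(1)})\}$ of the starting point $x_1^{(1)}$; (ii) $f$ has a minimizer $x_*$ with $G(x_*)$ nonsingular; (iii) $G$ is Lipschitz continuous in a neighbourhood of $x_*$. Let $0<\alpha<\tfrac12$ and $\alpha<\beta<1$. A step size $\lambda$ is called admissible at $x$ in the direction $d$ if $$f(x+\lambda d)\le f(x)+\alpha\lambda\langle g(x),d\rangle\quad\text{and}\quad \langle g(x+\lambda d),d\rangle\ge\beta\langle g(x),d\rangle .$$ Let $0<\tau\le m$, where $mI\preceq G(x)$ for all $x$ in some neighbourhood of $x_*$. Block BFGS with block size $q$, started with $x_1^{(1)}$ and a positive definite matrix $B_1$, proceeds as follows. In block $k=1,2,\dots$, for $i=1,\dots,q$, put $d_k^{(i)}=-B_k^{-1}g(x_k^{(i)})$, choose an admissible step size $\lambda_k^{(i)}>0$ at $x_k^{(i)}$ in the direction $d_k^{(i)}$, where $\lambda_k^{(i)}=1$ is always chosen if it is admissible, and put $s_k^{(i)}=\lambda_k^{(i)}d_k^{(i)}$,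 $x_k^{(i+1)}=x_k^{(i)}+s_k^{(i)}$. At the end of the block put $G_k=G(x_k^{(q+1)})$, $x_{k+1}^{(1)}=x_k^{(q+1)}$, and form a matrix $D_k$ whose columns are steps of the block: choose by any rule a nonempty list of distinct steps of the block (for instance all of them), in any order, and examine the steps in this order, retaining a step $s$ as the next column if and only if $\sigma^2\ge\tau\|s\|^2$, where $\sigma^2$ is the last diagonal entry of $\Sigma$ in the decomposition $L\Sigma L^T$ ($L$ lower triangular with unit diagonal, $\Sigma$ diagonal) of $D^TG_kD$, $D$ being the matrix of the columns retained so far followed by $s$. If $D_k$ is empty, then $B_{k+1}=B_k$; otherwise $$B_{k+1}=B_k-B_kD_k(D_k^TB_kD_k)^{-1}D_k^TB_k+G_kD_k(D_k^TG_kD_k)^{-1}D_k^TG_k .$$ Suppose that, for all sufficiently large $k$, $D_k$ contains a step $s_k^{(i)}$ for which $\lambda=1$ is not admissible (at $x_k^{(i)}$ in the direction $d_k^{(i)}$), whenever the $k$-th block contains such a step. Then $\lambda=1$ is eventually admissible for all steps: there is a $K$ such that for all $k\ge K$ and all $i=1,\dots,q$, the step size $\lambda=1$ is admissible at $x_k^{(i)}$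 in the direction $d_k^{(i)}$. -/

import Mathlib

open Filter Topology
open scoped Matrix NNReal

namespace BlockBFGS

/-- The Hessian of `f`, as a continuous linear map: the derivative of the gradient. -/
noncomputable def hessianCLM {n : ℕ} (f : EuclideanSpace ℝ (Fin n) → ℝ)
    (x : EuclideanSpace ℝ (Fin n)) :
    EuclideanSpace ℝ (Fin n) →L[ℝ] EuclideanSpace ℝ (Fin n) :=
  fderiv ℝ (gradient f) x

/-- The Hessian matrix `G(x)` of `f`. -/
noncomputable def hessian {n : ℕ} (f : EuclideanSpace ℝ (Fin n) → ℝ)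
    (x : EuclideanSpace ℝ (Fin n)) : Matrix (Fin n) (Fin n) ℝ :=
  (Matrix.toEuclideanCLM (n := Fin n) (𝕜 := ℝ)).symm (hessianCLM f x)

/-- The standing assumptions on the objective `f`, for the starting point `x₁` and the
minimizer `xstar`. -/
structure Objective {n : ℕ} (f : EuclideanSpace ℝ (Fin n) → ℝ)
    (x₁ xstar : EuclideanSpace ℝ (Fin n)) (M : ℝ) (μ : ℝ≥0) : Prop where
  convex : ConvexOn ℝ Set.univ f
  differentiable : Differentiable ℝ f
  twice_differentiable : Differentiable ℝ (gradient f)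
  hessian_le : ∀ y, f y ≤ f x₁ → (M • (1 : Matrix (Fin n) (Fin n) ℝ) - hessian f y).PosSemidef
  isMin : ∀ y, f xstar ≤ f y
  nonsingular : IsUnit (hessian f xstar).det
  hessian_lipschitz : ∃ U ∈ 𝓝 xstar, LipschitzOnWith μ (hessianCLM f) U

/-- The step size `lam` is admissible at `x` in the direction `d`: the Armijo condition and the
Wolfe condition hold. -/
def StepAdmissible {n : ℕ} (f : EuclideanSpace ℝ (Fin n) → ℝ) (α β : ℝ)
    (x d : EuclideanSpace ℝ (Fin n)) (lam : ℝ) : Prop :=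
  f (x + lam • d) ≤ f x + α * lam * inner ℝ (gradient f x) d ∧
    β * inner ℝ (gradient f x) d ≤ inner ℝ (gradient f (x + lam • d)) d

/-- `lam` is a possible output of the Armijo-Wolfe line search, which selects the unit step
whenever the unit step is admissible. -/
def LineSearch {n : ℕ} (f : EuclideanSpace ℝ (Fin n) → ℝ) (α β : ℝ)
    (x d : EuclideanSpace ℝ (Fin n)) (lam : ℝ) : Prop :=
  0 < lam ∧ StepAdmissible f α β x d lam ∧ (StepAdmissible f α β x d 1 → lam = 1)

/-- The `L Σ Lᵀ` recursion, column by column. For the column `j` it returns the pair consisting of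
`Σ_jj = A_jj - ∑_{l<j} L_jl² Σ_ll` and of the column `i ↦ L_ij`, where
`L_ij = (A_ij - ∑_{l<j} L_jl L_il Σ_ll) / Σ_jj` for `j < i`. -/
noncomputable def ldl {p : ℕ} (A : Matrix (Fin p) (Fin p) ℝ) (j : Fin p) : ℝ × (Fin p → ℝ) :=
  let sig : ℝ := A j j - ∑ l : {l : Fin p // l < j}, (ldl A l.1).2 j ^ 2 * (ldl A l.1).1
  (sig, fun i =>
    if i < j then 0
    else if i = j then 1
    else (A i j
      - ∑ l : {l : Fin p // l < j}, (ldl A l.1).2 j * (ldl A l.1).2 i * (ldl A l.1).1) / sig)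
termination_by j
decreasing_by all_goals exact l.2

/-- The matrix whose columns are the vectors `s i`, for `i` running through the list `J`. -/
def colMatrix {n : ℕ} {ι : Type*} (s : ι → EuclideanSpace ℝ (Fin n)) (J : List ι) :
    Matrix (Fin n) (Fin J.length) ℝ :=
  Matrix.of fun a c => s (J.get c) a

/-- The number `σ²` computed for a new last column `s i`, when the columns in `kept` have been
retained: the last diagonal entry of `Σ` in the `L Σ Lᵀ` recursion for `Dᵀ G D`. -/
noncomputable def pivot {n : ℕ} {ι : Type*} (G : Matrix (Fin n) (Fin n) ℝ)
    (s : ι → EuclideanSpace ℝ (Fin n)) (kept : List ι) (i : ι) : ℝ :=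
  (ldl ((colMatrix s (kept ++ [i]))ᵀ * G * colMatrix s (kept ++ [i]))
    ⟨kept.length, by simp⟩).1

open Classical in
/-- The loop of the filtering procedure: the columns in `kept` have already been retained, those in
the second list are still to be examined, in this order. -/
noncomputable def filterLoop {n : ℕ} {ι : Type*} (G : Matrix (Fin n) (Fin n) ℝ) (τ : ℝ)
    (s : ι → EuclideanSpace ℝ (Fin n)) : List ι → List ι → List ι
  | kept, [] => kept
  | kept, i :: rest =>
      if τ * ‖s i‖ ^ 2 ≤ pivot G s kept i then filterLoop G τ s (kept ++ [i]) rest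
      else filterLoop G τ s kept rest

/-- The filtering procedure, applied to the columns `s i`, `i ∈ J`, in the order of the list `J`.
It returns the list of the indices of the retained columns. -/
noncomputable def filterSteps {n : ℕ} {ι : Type*} (G : Matrix (Fin n) (Fin n) ℝ) (τ : ℝ)
    (s : ι → EuclideanSpace ℝ (Fin n)) (J : List ι) : List ι :=
  filterLoop G τ s [] J

/-- The Block BFGS update of `B` for the matrix `D` of retained steps and the Hessian `G`. -/
noncomputable def update {n p : ℕ} (B G : Matrix (Fin n) (Fin n) ℝ)
    (D : Matrix (Fin n) (Fin p) ℝ) : Matrix (Fin n) (Fin n) ℝ :=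
  B - B * D * (Dᵀ * B * D)⁻¹ * Dᵀ * B + G * D * (Dᵀ * G * D)⁻¹ * Dᵀ * G

section Run

variable {n q : ℕ} (f : EuclideanSpace ℝ (Fin n) → ℝ) (τ : ℝ)
  (x : ℕ → Fin (q + 1) → EuclideanSpace ℝ (Fin n)) (B : ℕ → Matrix (Fin n) (Fin n) ℝ)
  (lam : ℕ → Fin q → ℝ) (cand : ℕ → List (Fin q))

/-- The direction `d_k^(i) = -B_k⁻¹ g(x_k^(i))`. -/
noncomputable def direction (k : ℕ) (i : Fin q) : EuclideanSpace ℝ (Fin n) :=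
  -Matrix.toEuclideanCLM (n := Fin n) (𝕜 := ℝ) (B k)⁻¹ (gradient f (x k i.castSucc))

/-- The step `s_k^(i) = λ_k^(i) d_k^(i)`. -/
noncomputable def step (k : ℕ) (i : Fin q) : EuclideanSpace ℝ (Fin n) :=
  lam k i • direction f x B k i

/-- The Hessian `G_k` at the last iterate of the `k`-th block. -/
noncomputable def blockHessian (k : ℕ) : Matrix (Fin n) (Fin n) ℝ :=
  hessian f (x k (Fin.last q))

/-- The indices of the steps that are the columns of `D_k`: the output of the filtering procedure
for the steps of the `k`-th block listed in `cand k`, in that order. -/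
noncomputable def selected (k : ℕ) : List (Fin q) :=
  filterSteps (blockHessian f x k) τ (step f x B lam k) (cand k)

/-- The sequences `x`, `B`, `lam` are produced by Block BFGS with blocks of `q` steps (blocks and
steps are numbered from `0`). The rule by which `D_k` is selected from the `k`-th block is free:
`cand k` lists the steps submitted to the filtering procedure, in the order in which they are
examined. It may be any nonempty list of distinct steps of the block, for instance all of them in
any order. -/
structure IsRun (α β : ℝ) : Prop where
  posDef : (B 0).PosDef
  lineSearch : ∀ k i, LineSearch f α β (x k i.castSucc) (direction f x B k i) (lam k i)
  iterate : ∀ k (i : Fin q), x k i.succ = x k i.castSucc + step f x B lam k i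
  next_block : ∀ k, x (k + 1) 0 = x k (Fin.last q)
  cand_ne_nil : ∀ k, cand k ≠ []
  cand_nodup : ∀ k, (cand k).Nodup
  update_eq : ∀ k, selected f τ x B lam cand k ≠ [] →
    B (k + 1) = update (B k) (blockHessian f x k)
      (colMatrix (step f x B lam k) (selected f τ x B lam cand k))
  no_update : ∀ k, selected f τ x B lam cand k = [] → B (k + 1) = B k

end Run

end BlockBFGS

/-!
The proof measures a matrix `B` by the Byrd-Nocedal potential `tr(W⁻¹ B) - log det B` with respect
to a positive definite matrix `W`. It is bounded below (`exists_le_potential`). A BFGS update of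
`B` for the direction `v` and the Hessian `G` changes it by `gain W G v - gain W B v`, where the
gain is nonnegative, at least `-log cos²` of the angle between `v` and `B v`, and small only if
`B v` is close to `W v`. A Block BFGS update depends on the range of `D` only, and it is the
composition of BFGS updates for `G`-conjugate directions spanning this range, the first of which
may be chosen freely (`blockUpdate_split`). So a block update removes the gain of any retained step
from the potential, and adds at most the gains of `G` on the range of `D`
(`blockUpdate_potential`).

*Convergence* (`Progress.exists_lt`). Take `W = I`. The pivot test of the filtering procedure
bounds `G` from below on the span of the retained steps (`exists_coercive_of_pivotsPass`), so that
the potential grows by at most a constant in each block. The Armijo and Wolfe conditions give a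
decrease of `f` proportional to `cos² θ ‖g‖²`. If the values of `f` did not tend to the minimum,
then all `cos² θ` would tend to zero, every update would lower the potential by at least `1`, only
finitely many updates would take place, and a fixed matrix would keep `cos² θ` away from zero.

*Rate* (`Progress.summable_norm`). Near the minimizer some step is retained in every block, and
`cos² θ` is at least a multiple of `1` plus the increase of the potential. Hence `f - f(x_*)` times
the exponential of a multiple of the potential decreases geometrically, and the distances of the
iterates to `x_*` are summable.

*Retained steps* (`Progress.eventually_stepAdmissible`). Take `W = G(x_*)`. By Lipschitz continuity
of the Hessian the potential now increases by summable amounts only, so that the gains of all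
retained steps tend to zero: a retained direction `d` solves `G(x_*) d = - g(x)` with a relative
error that tends to zero. Near `x_*` the unit step is admissible for such directions
(`exists_stepAdmissible_one`). As a late block with an inadmissible unit step would retain such a
step, there is none. A run that hits `x_*` stays there, and is treated separately.
-/

namespace BlockBFGS

open Matrix

/-! ### Block updates and the potential -/

section MatrixTheory

variable {ν ι κ : Type*} [Fintype ν] [Fintype ι]

lemma posDef_iff_real {A : Matrix ν ν ℝ} :
    A.PosDef ↔ Aᵀ = A ∧ ∀ x : ν → ℝ, x ≠ 0 → 0 < x ⬝ᵥ A *ᵥ x := by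
  constructor
  · intro h
    refine ⟨?_, fun x hx => by simpa using h.dotProduct_mulVec_pos hx⟩
    have := h.1
    rwa [IsHermitian, conjTranspose_eq_transpose_of_trivial] at this
  · rintro ⟨h1, h2⟩
    refine PosDef.of_dotProduct_mulVec_pos ?_ fun x hx => by simpa using h2 x hx
    rwa [IsHermitian, conjTranspose_eq_transpose_of_trivial]

lemma posSemidef_real {A : Matrix ν ν ℝ} (h : A.PosSemidef) :
    Aᵀ = A ∧ ∀ x : ν → ℝ, 0 ≤ x ⬝ᵥ A *ᵥ x := by
  refine ⟨?_, fun x => by simpa using h.dotProduct_mulVec_nonneg x⟩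
  have := h.1
  rwa [IsHermitian, conjTranspose_eq_transpose_of_trivial] at this

lemma dotProduct_mulVec_comm_of_symm {A : Matrix ν ν ℝ} (hA : Aᵀ = A) (x y : ν → ℝ) :
    x ⬝ᵥ A *ᵥ y = y ⬝ᵥ A *ᵥ x := by
  rw [dotProduct_mulVec, ← mulVec_transpose, hA, dotProduct_comm]

/-- The Cauchy-Schwarz inequality for a positive semidefinite form. -/
lemma sq_dotProduct_mulVec_le {A : Matrix ν ν ℝ} (hA : Aᵀ = A)
    (h : ∀ x : ν → ℝ, 0 ≤ x ⬝ᵥ A *ᵥ x) (x y : ν → ℝ) :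
    (x ⬝ᵥ A *ᵥ y) ^ 2 ≤ (x ⬝ᵥ A *ᵥ x) * (y ⬝ᵥ A *ᵥ y) := by
  have key : ∀ t : ℝ, 0 ≤ (x ⬝ᵥ A *ᵥ x) * (t * t) + (2 * (x ⬝ᵥ A *ᵥ y)) * t
      + (y ⬝ᵥ A *ᵥ y) := by
    intro t
    have := h (t • x + y)
    simp only [mulVec_add, mulVec_smul, add_dotProduct, dotProduct_add, smul_dotProduct,
      dotProduct_smul, smul_eq_mul, dotProduct_mulVec_comm_of_symm hA y x] at this
    linarith
  have := discrim_le_zero key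
  rw [discrim] at this
  nlinarith

/-- The BFGS update of `B` for the single direction `s`. -/
noncomputable def rankOneUpdate (B G : Matrix ν ν ℝ) (s : ν → ℝ) : Matrix ν ν ℝ :=
  B - (s ⬝ᵥ B *ᵥ s)⁻¹ • vecMulVec (B *ᵥ s) (B *ᵥ s)
    + (s ⬝ᵥ G *ᵥ s)⁻¹ • vecMulVec (G *ᵥ s) (G *ᵥ s)

lemma posDef_gram {A : Matrix ν ν ℝ} (hA : Aᵀ = A) {D : Matrix ν ι ℝ}
    (h : ∀ z : ι → ℝ, z ≠ 0 → 0 < (D *ᵥ z) ⬝ᵥ A *ᵥ (D *ᵥ z)) : (Dᵀ * A * D).PosDef := by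
  refine posDef_iff_real.2 ⟨by simp [transpose_mul, hA, Matrix.mul_assoc], fun z hz => ?_⟩
  have := h z hz
  rwa [← mulVec_mulVec, ← mulVec_mulVec, dotProduct_mulVec, vecMul_transpose]

lemma rankOneUpdate_mulVec (B G : Matrix ν ν ℝ) (s x : ν → ℝ) :
    rankOneUpdate B G s *ᵥ x = B *ᵥ x - ((s ⬝ᵥ B *ᵥ s)⁻¹ * ((B *ᵥ s) ⬝ᵥ x)) • (B *ᵥ s)
      + ((s ⬝ᵥ G *ᵥ s)⁻¹ * ((G *ᵥ s) ⬝ᵥ x)) • (G *ᵥ s) := by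
  simp [rankOneUpdate, add_mulVec, sub_mulVec, smul_mulVec, vecMulVec_mulVec, smul_smul]

lemma posDef_rankOneUpdate {B G : Matrix ν ν ℝ} (hB : B.PosDef) {s : ν → ℝ}
    (hγ : 0 < s ⬝ᵥ G *ᵥ s) : (rankOneUpdate B G s).PosDef := by
  obtain ⟨hBs, hBp⟩ := posDef_iff_real.1 hB
  have hs : s ≠ 0 := by rintro rfl; simp at hγ
  have ha := hBp s hs
  refine posDef_iff_real.2 ⟨?_, fun x hx => ?_⟩
  · simp [rankOneUpdate, transpose_vecMulVec, hBs]
  set t := (s ⬝ᵥ B *ᵥ s)⁻¹ * ((B *ᵥ s) ⬝ᵥ x) with ht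
  have hta : (B *ᵥ s) ⬝ᵥ x = t * (s ⬝ᵥ B *ᵥ s) := by rw [ht]; field_simp
  have hxs : x ⬝ᵥ B *ᵥ s = t * (s ⬝ᵥ B *ᵥ s) := by rw [dotProduct_comm, hta]
  have hsx : s ⬝ᵥ B *ᵥ x = t * (s ⬝ᵥ B *ᵥ s) := by
    rw [dotProduct_mulVec_comm_of_symm hBs, hxs]
  have hval : x ⬝ᵥ rankOneUpdate B G s *ᵥ x
      = (x - t • s) ⬝ᵥ B *ᵥ (x - t • s) + (s ⬝ᵥ G *ᵥ s)⁻¹ * ((G *ᵥ s) ⬝ᵥ x) ^ 2 := by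
    rw [rankOneUpdate_mulVec, ← ht]
    simp only [mulVec_sub, mulVec_smul, sub_dotProduct, dotProduct_sub, smul_dotProduct,
      dotProduct_smul, smul_eq_mul, dotProduct_add, hxs, hsx, dotProduct_comm x (G *ᵥ s)]
    ring
  rw [hval]
  have h2 : 0 ≤ (s ⬝ᵥ G *ᵥ s)⁻¹ * ((G *ᵥ s) ⬝ᵥ x) ^ 2 := by positivity
  by_cases hy : x - t • s = 0
  · have hxt : x = t • s := sub_eq_zero.1 hy
    have ht0 : t ≠ 0 := by
      intro h0; apply hx; rw [hxt, h0, zero_smul]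
    have : (G *ᵥ s) ⬝ᵥ x = t * (s ⬝ᵥ G *ᵥ s) := by
      rw [hxt, dotProduct_smul, dotProduct_comm, smul_eq_mul]
    rw [hy, this]
    simp only [zero_dotProduct, zero_add]
    positivity
  · have := hBp _ hy
    linarith

variable [DecidableEq ι] [Fintype κ] [DecidableEq κ]

/-- The matrix `A D (Dᵀ A D)⁻¹ Dᵀ A`. -/
noncomputable def shadow (A : Matrix ν ν ℝ) (D : Matrix ν ι ℝ) : Matrix ν ν ℝ :=
  A * D * (Dᵀ * A * D)⁻¹ * Dᵀ * A

/-- The Block BFGS update with columns indexed by an arbitrary finite type. -/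
noncomputable def blockUpdate (B G : Matrix ν ν ℝ) (D : Matrix ν ι ℝ) : Matrix ν ν ℝ :=
  B - shadow B D + shadow G D

/-- `shadow A D` is the only matrix with column space in that of `A D` which agrees with `A` on
the rows given by `Dᵀ`; in particular it depends on the range of `D` only. -/
lemma eq_shadow {A X : Matrix ν ν ℝ} {D : Matrix ν ι ℝ} (hY : IsUnit (Dᵀ * A * D).det)
    (K : Matrix ι ν ℝ) (hK : X = A * D * K) (hX : Dᵀ * X = Dᵀ * A) : shadow A D = X := by
  have h1 : (Dᵀ * A * D) * K = Dᵀ * A := by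
    rw [Matrix.mul_assoc Dᵀ A D, Matrix.mul_assoc Dᵀ, ← hK, hX]
  have h2 : (Dᵀ * A * D)⁻¹ * (Dᵀ * A) = K := by
    nth_rw 2 [← h1]
    rw [← Matrix.mul_assoc, nonsing_inv_mul _ hY, Matrix.one_mul]
  conv_rhs => rw [hK, ← h2]
  rw [shadow]
  simp only [Matrix.mul_assoc]

/-- Splitting off a direction `s` that is `A`-conjugate to the remaining columns. -/
lemma shadow_split {A : Matrix ν ν ℝ} (hA : Aᵀ = A) {D : Matrix ν ι ℝ} {D' : Matrix ν κ ℝ}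
    {s : ν → ℝ} (hY : IsUnit (Dᵀ * A * D).det) (hY' : IsUnit (D'ᵀ * A * D').det)
    (ha : s ⬝ᵥ A *ᵥ s ≠ 0) {c : ι → ℝ} (hs : s = D *ᵥ c) {R : Matrix ι κ ℝ} (hD' : D' = D * R)
    {t : ι → ℝ} {T : Matrix κ ι ℝ} (hD : D = vecMulVec s t + D' * T)
    (hconj : D'ᵀ *ᵥ (A *ᵥ s) = 0) :
    shadow A D = (s ⬝ᵥ A *ᵥ s)⁻¹ • vecMulVec (A *ᵥ s) (A *ᵥ s) + shadow A D' := by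
  have hsD : (A *ᵥ s) ᵥ* D' = 0 := by rw [← mulVec_transpose, hconj]
  refine eq_shadow hY ((s ⬝ᵥ A *ᵥ s)⁻¹ • vecMulVec c (A *ᵥ s)
    + R * (D'ᵀ * A * D')⁻¹ * D'ᵀ * A) ?_ ?_
  · rw [Matrix.mul_add, Matrix.mul_smul, mul_vecMulVec, ← mulVec_mulVec, ← hs, shadow]
    congr 1
    conv_lhs => rw [hD']
    conv_rhs => rw [hD']
    simp only [Matrix.mul_assoc]
  · have hrow : s ᵥ* A = A *ᵥ s := by rw [← mulVec_transpose, hA]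
    have e1 : s ᵥ* ((s ⬝ᵥ A *ᵥ s)⁻¹ • vecMulVec (A *ᵥ s) (A *ᵥ s) + shadow A D') = s ᵥ* A := by
      rw [vecMul_add, vecMul_smul, vecMul_vecMulVec, smul_smul, inv_mul_cancel₀ ha, one_smul, hrow,
        shadow]
      simp only [Matrix.mul_assoc]
      rw [← vecMul_vecMul, ← vecMul_vecMul, hrow, hsD, zero_vecMul, add_zero]
    have e2 : D'ᵀ * ((s ⬝ᵥ A *ᵥ s)⁻¹ • vecMulVec (A *ᵥ s) (A *ᵥ s) + shadow A D') = D'ᵀ * A := by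
      rw [Matrix.mul_add, Matrix.mul_smul, mul_vecMulVec, hconj, shadow]
      have : D'ᵀ * (A * D' * (D'ᵀ * A * D')⁻¹ * D'ᵀ * A)
          = (D'ᵀ * A * D') * (D'ᵀ * A * D')⁻¹ * (D'ᵀ * A) := by simp only [Matrix.mul_assoc]
      rw [this, mul_nonsing_inv _ hY', Matrix.one_mul]
      simp [zero_vecMulVec]
    conv_lhs => rw [hD]
    conv_rhs => rw [hD]
    rw [transpose_add, transpose_mul, transpose_vecMulVec, Matrix.add_mul, Matrix.add_mul,
      vecMulVec_mul, vecMulVec_mul, e1, Matrix.mul_assoc, e2, Matrix.mul_assoc]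

/-- Two-step form of the block update: the BFGS update for one direction `s` in the range of
`D`, followed by the block update for the part of the range that is `G`-conjugate to `s`. -/
lemma blockUpdate_split {B G : Matrix ν ν ℝ} (hB : B.PosDef) (hG : Gᵀ = G) {D : Matrix ν ι ℝ}
    (hpos : ∀ z : ι → ℝ, z ≠ 0 → 0 < (D *ᵥ z) ⬝ᵥ G *ᵥ (D *ᵥ z))
    {c : ι → ℝ} (hc : c ≠ 0) {R : Matrix ι κ ℝ} (hR : ∀ w, R *ᵥ w = 0 → w = 0)
    {t : ι → ℝ} {T : Matrix κ ι ℝ} (hT : (1 : Matrix ι ι ℝ) = vecMulVec c t + R * T)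
    (hconj : (D * R)ᵀ *ᵥ (G *ᵥ (D *ᵥ c)) = 0) :
    blockUpdate B G D = blockUpdate (rankOneUpdate B G (D *ᵥ c)) G (D * R) := by
  obtain ⟨hBs, hBp⟩ := posDef_iff_real.1 hB
  set s := D *ᵥ c with hs
  set D' := D * R with hD'
  have hγ : 0 < s ⬝ᵥ G *ᵥ s := hpos c hc
  have hs0 : s ≠ 0 := by rintro h; simp [h] at hγ
  have ha : 0 < s ⬝ᵥ B *ᵥ s := hBp s hs0
  have hinj : ∀ z, z ≠ 0 → D *ᵥ z ≠ 0 := fun z hz h => by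
    have := hpos z hz; simp [h] at this
  have hposB : ∀ z : ι → ℝ, z ≠ 0 → 0 < (D *ᵥ z) ⬝ᵥ B *ᵥ (D *ᵥ z) :=
    fun z hz => hBp _ (hinj z hz)
  have hpos' : ∀ w : κ → ℝ, w ≠ 0 → 0 < (D' *ᵥ w) ⬝ᵥ G *ᵥ (D' *ᵥ w) := fun w hw => by
    rw [hD', ← mulVec_mulVec]; exact hpos _ fun h => hw (hR w h)
  have hD : D = vecMulVec s t + D' * T := by
    rw [hs, hD', ← mul_vecMulVec, Matrix.mul_assoc, ← Matrix.mul_add, ← hT, Matrix.mul_one]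
  -- the columns of `D'` made `B`-conjugate to `s`
  set r : κ → ℝ := (s ⬝ᵥ B *ᵥ s)⁻¹ • (D'ᵀ *ᵥ (B *ᵥ s)) with hr
  set D'' := D' - vecMulVec s r with hD''
  have hconj'' : D''ᵀ *ᵥ (B *ᵥ s) = 0 := by
    rw [hD'', transpose_sub, sub_mulVec, transpose_vecMulVec, vecMulVec_mulVec, hr]
    simp [smul_smul, mul_inv_cancel₀ ha.ne']
  have hsD'' : (B *ᵥ s) ᵥ* D'' = 0 := by rw [← mulVec_transpose, hconj'']
  have hD''R : D'' = D * (R - vecMulVec c r) := by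
    rw [hD'', Matrix.mul_sub, mul_vecMulVec]
  have hDr : D = vecMulVec s (t + r ᵥ* T) + D'' * T := by
    rw [hD'', Matrix.sub_mul, vecMulVec_mul, vecMulVec_add]
    conv_lhs => rw [hD]
    abel
  have hY'' : (D''ᵀ * B * D'').PosDef := by
    refine posDef_gram hBs fun w hw => hBp _ fun h0 => ?_
    -- a vector of the range of `D'` parallel to `s` vanishes, being `G`-conjugate to `s`
    have h1 : D' *ᵥ w = (r ⬝ᵥ w) • s := by
      rw [hD'', sub_mulVec, vecMulVec_mulVec] at h0
      simpa using sub_eq_zero.1 h0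
    have h2 : (D' *ᵥ w) ⬝ᵥ G *ᵥ s = 0 := by
      rw [dotProduct_comm, dotProduct_mulVec, ← mulVec_transpose, hconj, zero_dotProduct]
    have h3 := hpos' w hw
    rw [h1] at h2 h3
    simp only [smul_dotProduct, mulVec_smul, dotProduct_smul, smul_eq_mul] at h2 h3
    rcases mul_eq_zero.1 h2 with h | h
    · simp [h] at h3
    · exact hγ.ne' h
  have uY := (posDef_gram hG hpos).det_pos.ne'.isUnit
  have uX := (posDef_gram hBs hposB).det_pos.ne'.isUnit
  have uY' := (posDef_gram hG hpos').det_pos.ne'.isUnit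
  have eG := shadow_split hG uY uY' hγ.ne' hs hD' hD hconj
  have eB := shadow_split hBs uX hY''.det_pos.ne'.isUnit ha.ne' hs hD''R hDr hconj''
  have hsG : (G *ᵥ s) ᵥ* D' = 0 := by rw [← mulVec_transpose, hconj]
  have hz : vecMulVec (G *ᵥ s) (0 : κ → ℝ) = 0 := by ext; simp [vecMulVec_apply]
  have eD : rankOneUpdate B G s * D' = B * D'' := by
    rw [rankOneUpdate, Matrix.add_mul, Matrix.sub_mul, smul_mul, smul_mul, vecMulVec_mul,
      vecMulVec_mul, hsG, hD'', Matrix.mul_sub, mul_vecMulVec, hr, ← mulVec_transpose,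
      vecMulVec_smul, hz, smul_zero, add_zero]
  have sB1 : (rankOneUpdate B G s)ᵀ = rankOneUpdate B G s :=
    (posDef_iff_real.1 (posDef_rankOneUpdate hB hγ)).1
  have eD' : D'ᵀ * rankOneUpdate B G s = D''ᵀ * B := by
    have := congrArg transpose eD
    rwa [transpose_mul _ D', transpose_mul B, sB1, hBs] at this
  have hgram : D'ᵀ * rankOneUpdate B G s * D' = D''ᵀ * B * D'' := by
    rw [Matrix.mul_assoc, eD]
    have : D' = D'' + vecMulVec s r := by rw [hD'']; abel
    rw [this, transpose_add, Matrix.add_mul, transpose_vecMulVec, vecMulVec_mul,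
      ← vecMul_vecMul, ← mulVec_transpose B, hBs, hsD'']
    simp [Matrix.mul_assoc]
  have eS : shadow (rankOneUpdate B G s) D' = shadow B D'' := by
    unfold shadow
    rw [Matrix.mul_assoc _ D'ᵀ, hgram, eD, eD']
    simp only [Matrix.mul_assoc]
  rw [blockUpdate, eG, eB, blockUpdate, eS]
  conv_rhs => rw [rankOneUpdate]
  abel

variable [DecidableEq ν]

lemma sq_dotProduct_le_inv {W : Matrix ν ν ℝ} (hW : W.PosDef) (v u : ν → ℝ) :
    (v ⬝ᵥ u) ^ 2 ≤ (v ⬝ᵥ W *ᵥ v) * (u ⬝ᵥ W⁻¹ *ᵥ u) := by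
  obtain ⟨hs, hp⟩ := posDef_iff_real.1 hW
  have hdet : IsUnit W.det := hW.det_pos.ne'.isUnit
  have hp' : ∀ x : ν → ℝ, 0 ≤ x ⬝ᵥ W *ᵥ x := fun x => by
    by_cases hx : x = 0
    · simp [hx]
    · exact (hp x hx).le
  have := sq_dotProduct_mulVec_le hs hp' v (W⁻¹ *ᵥ u)
  rw [mulVec_mulVec, mul_nonsing_inv _ hdet, one_mulVec] at this
  rwa [dotProduct_comm (W⁻¹ *ᵥ u) u] at this

lemma det_rankOneUpdate {B G : Matrix ν ν ℝ} (hB : B.PosDef) {s : ν → ℝ}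
    (hγ : 0 < s ⬝ᵥ G *ᵥ s) :
    (rankOneUpdate B G s).det = B.det * ((s ⬝ᵥ G *ᵥ s) / (s ⬝ᵥ B *ᵥ s)) := by
  obtain ⟨hBs, hBp⟩ := posDef_iff_real.1 hB
  have hs : s ≠ 0 := by rintro rfl; simp at hγ
  have ha := hBp s hs
  have hdet : IsUnit B.det := hB.det_pos.ne'.isUnit
  set a := s ⬝ᵥ B *ᵥ s with ha'
  set γ := s ⬝ᵥ G *ᵥ s with hγ'
  let U : Matrix ν (Fin 2) ℝ := Matrix.of fun i => ![-(a⁻¹ * s i), γ⁻¹ * (B⁻¹ *ᵥ (G *ᵥ s)) i]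
  let V : Matrix (Fin 2) ν ℝ := Matrix.of ![B *ᵥ s, G *ᵥ s]
  have hUV : rankOneUpdate B G s = B * (1 + U * V) := by
    have hUV' : U * V = -(a⁻¹ • vecMulVec s (B *ᵥ s))
        + γ⁻¹ • vecMulVec (B⁻¹ *ᵥ (G *ᵥ s)) (G *ᵥ s) := by
      ext i j
      simp [U, V, Matrix.mul_apply, vecMulVec_apply, Fin.sum_univ_two]
      ring
    rw [hUV', Matrix.mul_add, Matrix.mul_add, Matrix.mul_neg, Matrix.mul_smul, Matrix.mul_smul,
      mul_vecMulVec, mul_vecMulVec, mulVec_mulVec, mul_nonsing_inv _ hdet, one_mulVec,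
      Matrix.mul_one, rankOneUpdate]
    abel
  have h11 : (V * U) 0 0 = -1 := by
    have : (V * U) 0 0 = -(a⁻¹ * (s ⬝ᵥ B *ᵥ s)) := by
      simp [U, V, Matrix.mul_apply, dotProduct, Finset.mul_sum]
      exact Finset.sum_congr rfl fun i _ => by ring
    rw [this, ← ha', inv_mul_cancel₀ ha.ne']
  have h10 : (V * U) 1 0 = -(a⁻¹ * γ) := by
    simp [U, V, Matrix.mul_apply, dotProduct, Finset.mul_sum, hγ']
    exact Finset.sum_congr rfl fun i _ => by ring
  have h01 : (V * U) 0 1 = 1 := by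
    have h2 : (V * U) 0 1 = γ⁻¹ * ((B *ᵥ s) ⬝ᵥ B⁻¹ *ᵥ (G *ᵥ s)) := by
      simp [U, V, Matrix.mul_apply, dotProduct, Finset.mul_sum]
      exact Finset.sum_congr rfl fun i _ => by ring
    rw [h2, dotProduct_comm, ← dotProduct_mulVec_comm_of_symm hBs, mulVec_mulVec,
      mul_nonsing_inv _ hdet, one_mulVec, ← hγ', inv_mul_cancel₀ hγ.ne']
  rw [hUV, det_mul, det_one_add_mul_comm, det_fin_two]
  simp only [Matrix.add_apply, h11, h10, h01, one_apply_eq]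
  norm_num
  left
  field_simp

/-- The Byrd-Nocedal potential `tr(W⁻¹ B) - log det B` of `B`, for a reference matrix `W`. -/
noncomputable def potential (W B : Matrix ν ν ℝ) : ℝ := (W⁻¹ * B).trace - Real.log B.det

/-- The decrease of the potential of `B` in a BFGS update for the direction `v` that uses `W` as
Hessian. For positive definite `B` and `W` it is nonnegative, and zero exactly if `B v = W v`. -/
noncomputable def gain (W B : Matrix ν ν ℝ) (v : ν → ℝ) : ℝ :=
  ((B *ᵥ v) ⬝ᵥ W⁻¹ *ᵥ (B *ᵥ v)) / (v ⬝ᵥ B *ᵥ v) - 1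
    - Real.log ((v ⬝ᵥ B *ᵥ v) / (v ⬝ᵥ W *ᵥ v))

lemma potential_rankOneUpdate {W B G : Matrix ν ν ℝ} (hW : W.PosDef) (hB : B.PosDef)
    {s : ν → ℝ} (hγ : 0 < s ⬝ᵥ G *ᵥ s) :
    potential W (rankOneUpdate B G s) = potential W B - gain W B s + gain W G s := by
  have hs : s ≠ 0 := by rintro rfl; simp at hγ
  have ha := (posDef_iff_real.1 hB).2 s hs
  have hN := (posDef_iff_real.1 hW).2 s hs
  have htr : (W⁻¹ * rankOneUpdate B G s).trace = (W⁻¹ * B).trace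
      - ((B *ᵥ s) ⬝ᵥ W⁻¹ *ᵥ (B *ᵥ s)) / (s ⬝ᵥ B *ᵥ s)
      + ((G *ᵥ s) ⬝ᵥ W⁻¹ *ᵥ (G *ᵥ s)) / (s ⬝ᵥ G *ᵥ s) := by
    simp only [rankOneUpdate, Matrix.mul_add, Matrix.mul_sub, Matrix.mul_smul, mul_vecMulVec,
      trace_add, trace_sub, trace_smul, trace_vecMulVec, smul_eq_mul]
    rw [dotProduct_comm (W⁻¹ *ᵥ _), dotProduct_comm (W⁻¹ *ᵥ _)]
    ring
  rw [potential, htr, det_rankOneUpdate hB hγ, Real.log_mul hB.det_pos.ne' (by positivity),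
    Real.log_div hγ.ne' ha.ne', potential, gain, gain, Real.log_div ha.ne' hN.ne',
    Real.log_div hγ.ne' hN.ne']
  ring

/-- The gain dominates minus the logarithm of the squared cosine of the angle between `v` and
`B v`. -/
lemma neg_log_le_gain {W B : Matrix ν ν ℝ} (hW : W.PosDef) (hB : B.PosDef) {v : ν → ℝ}
    (hv : v ≠ 0) :
    -Real.log ((v ⬝ᵥ B *ᵥ v) ^ 2 / (((B *ᵥ v) ⬝ᵥ W⁻¹ *ᵥ (B *ᵥ v)) * (v ⬝ᵥ W *ᵥ v)))
      ≤ gain W B v := by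
  have ha := (posDef_iff_real.1 hB).2 v hv
  have hN := (posDef_iff_real.1 hW).2 v hv
  have hBv : B *ᵥ v ≠ 0 := fun h => by simp [h] at ha
  have hb := (posDef_iff_real.1 hW.inv).2 _ hBv
  rw [gain]
  set a := v ⬝ᵥ B *ᵥ v
  set N := v ⬝ᵥ W *ᵥ v
  set b := (B *ᵥ v) ⬝ᵥ W⁻¹ *ᵥ (B *ᵥ v)
  have h := Real.log_le_sub_one_of_pos (div_pos hb ha)
  rw [Real.log_div (by positivity) (by positivity), Real.log_pow,
    Real.log_mul hb.ne' hN.ne', Real.log_div ha.ne' hN.ne']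
  rw [Real.log_div hb.ne' ha.ne'] at h
  push_cast
  linarith

lemma gain_nonneg {W B : Matrix ν ν ℝ} (hW : W.PosDef) (hB : B.PosDef) {v : ν → ℝ}
    (hv : v ≠ 0) : 0 ≤ gain W B v := by
  have ha := (posDef_iff_real.1 hB).2 v hv
  have hN := (posDef_iff_real.1 hW).2 v hv
  have hBv : B *ᵥ v ≠ 0 := fun h => by simp [h] at ha
  have hb := (posDef_iff_real.1 hW.inv).2 _ hBv
  refine le_trans ?_ (neg_log_le_gain hW hB hv)
  rw [neg_nonneg]
  refine Real.log_nonpos (by positivity) ((div_le_one (by positivity)).2 ?_)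
  rw [mul_comm]
  exact sq_dotProduct_le_inv hW v (B *ᵥ v)

/-- Coordinates adapted to a hyperplane and a vector outside it. -/
lemma exists_complement {p : ℕ} (c ℓ : Fin (p + 1) → ℝ) (h : ℓ ⬝ᵥ c ≠ 0) :
    ∃ (R : Matrix (Fin (p + 1)) (Fin p) ℝ) (t : Fin (p + 1) → ℝ)
      (T : Matrix (Fin p) (Fin (p + 1)) ℝ), (∀ w, R *ᵥ w = 0 → w = 0) ∧
      (1 : Matrix (Fin (p + 1)) (Fin (p + 1)) ℝ) = vecMulVec c t + R * T ∧ Rᵀ *ᵥ ℓ = 0 := by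
  -- the hyperplane is the orthogonal complement of `ℓ`; `t` reads off the coordinate along `c`
  obtain ⟨j, hj⟩ : ∃ j, ℓ j ≠ 0 := by
    by_contra! h0
    exact h (by simp [dotProduct, h0])
  -- the basis of the hyperplane: `e_i - (ℓ_i / ℓ_j) e_j` for `i ≠ j`
  refine ⟨Matrix.of fun a i => if a = j then -(ℓ (j.succAbove i) / ℓ j)
    else if a = j.succAbove i then 1 else 0, (ℓ ⬝ᵥ c)⁻¹ • ℓ,
    Matrix.of fun i a => (if a = j.succAbove i then 1 else 0)
      - c (j.succAbove i) * ((ℓ ⬝ᵥ c)⁻¹ * ℓ a), ?_, ?_, ?_⟩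
  · intro w hw
    ext i
    have := congrFun hw (j.succAbove i)
    simpa [mulVec, dotProduct, Fin.succAbove_ne, Fin.succAbove_right_inj] using this
  · ext a b
    rcases eq_or_ne a j with rfl | ha
    · simp only [Matrix.add_apply, vecMulVec_apply, Matrix.mul_apply, Matrix.of_apply, if_true,
        Pi.smul_apply, smul_eq_mul, mul_sub, Finset.sum_sub_distrib]
      have e1 : ∑ i, -(ℓ (a.succAbove i) / ℓ a) * (c (a.succAbove i) * ((ℓ ⬝ᵥ c)⁻¹ * ℓ b))
          = -((ℓ ⬝ᵥ c)⁻¹ * ℓ b / ℓ a) * (ℓ ⬝ᵥ c - ℓ a * c a) := by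
        rw [dotProduct, Fin.sum_univ_succAbove _ a, add_sub_cancel_left, Finset.mul_sum]
        exact Finset.sum_congr rfl fun i _ => by ring
      rw [e1]
      rcases Fin.eq_self_or_eq_succAbove a b with hb | ⟨i, hb⟩
      · subst hb
        simp [Fin.ne_succAbove]
        field_simp
        ring
      · subst hb
        simp [Fin.ne_succAbove, one_apply]
        field_simp
        ring
    · obtain ⟨i, rfl⟩ : ∃ i, j.succAbove i = a := Fin.exists_succAbove_eq ha
      simp only [Matrix.add_apply, vecMulVec_apply, Matrix.mul_apply, Matrix.of_apply, ha,
        if_false, Pi.smul_apply, smul_eq_mul, Fin.succAbove_right_inj, ite_mul, one_mul, zero_mul,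
        Finset.sum_ite_eq, Finset.mem_univ, if_true, one_apply]
      rw [add_sub_cancel]
      exact if_congr eq_comm rfl rfl
  · ext i
    simp only [mulVec, dotProduct, transpose_apply, Matrix.of_apply]
    rw [Fin.sum_univ_succAbove _ j]
    simp [Fin.succAbove_ne]
    field_simp
    ring

/-- Effect of a block update on the potential: a gain of each direction used is lost, and at
most `E` is added for each column. The loss is recorded for a single direction, which may be any
vector `D z` in the range of `D`. -/
theorem blockUpdate_potential {W G : Matrix ν ν ℝ} (hW : W.PosDef) (hG : Gᵀ = G) {E : ℝ} (p : ℕ) :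
    ∀ (B : Matrix ν ν ℝ) (D : Matrix ν (Fin p) ℝ), B.PosDef →
    (∀ z : Fin p → ℝ, z ≠ 0 → 0 < (D *ᵥ z) ⬝ᵥ G *ᵥ (D *ᵥ z) ∧ gain W G (D *ᵥ z) ≤ E) →
    (blockUpdate B G D).PosDef ∧ potential W (blockUpdate B G D) ≤ potential W B + p * E ∧
      ∀ z : Fin p → ℝ, z ≠ 0 →
        potential W (blockUpdate B G D) ≤ potential W B + p * E - gain W B (D *ᵥ z) := by
  induction p with
  | zero =>
    intro B D hB _
    have h0 : ∀ A : Matrix ν ν ℝ, shadow A D = 0 := fun A => by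
      simp only [shadow, Matrix.mul_assoc]
      ext i j
      simp only [Matrix.mul_apply, Finset.univ_eq_empty, Finset.sum_empty, Matrix.zero_apply,
        mul_zero, Finset.sum_const_zero]
    have : blockUpdate B G D = B := by rw [blockUpdate, h0, h0]; simp
    rw [this]
    refine ⟨hB, by simp, fun z hz => (hz (Subsingleton.elim _ _)).elim⟩
  | succ p ih =>
    intro B D hB h
    have main : ∀ c : Fin (p + 1) → ℝ, c ≠ 0 → (blockUpdate B G D).PosDef ∧
        potential W (blockUpdate B G D)
          ≤ potential W B + ((p + 1 : ℕ) : ℝ) * E - gain W B (D *ᵥ c) := by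
      intro c hc
      have hγ := (h c hc).1
      have hℓ : (Dᵀ *ᵥ (G *ᵥ (D *ᵥ c))) ⬝ᵥ c ≠ 0 := by
        rw [mulVec_transpose, ← dotProduct_mulVec, dotProduct_comm]
        exact hγ.ne'
      obtain ⟨R, t, T, hR, hT, hRℓ⟩ := exists_complement c _ hℓ
      have hconj : (D * R)ᵀ *ᵥ (G *ᵥ (D *ᵥ c)) = 0 := by
        rw [transpose_mul, ← mulVec_mulVec, hRℓ]
      rw [blockUpdate_split hB hG (fun z hz => (h z hz).1) hc hR hT hconj]
      obtain ⟨h1, h2, -⟩ := ih (rankOneUpdate B G (D *ᵥ c)) (D * R)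
        (posDef_rankOneUpdate hB hγ) fun w hw => by
          rw [← mulVec_mulVec]
          exact h _ fun h0 => hw (hR w h0)
      refine ⟨h1, h2.trans ?_⟩
      rw [potential_rankOneUpdate hW hB hγ]
      have := (h c hc).2
      push_cast
      linarith
    have h1 : (Pi.single 0 1 : Fin (p + 1) → ℝ) ≠ 0 := by
      intro h0
      have := congrFun h0 0
      simp at this
    obtain ⟨m1, m2⟩ := main _ h1
    have h2 : D *ᵥ (Pi.single 0 1 : Fin (p + 1) → ℝ) ≠ 0 := fun h0 => by
      have := (h _ h1).1
      simp [h0] at this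
    have := gain_nonneg hW hB h2
    exact ⟨m1, by linarith, fun z hz => (main z hz).2⟩

end MatrixTheory

/-! ### Bounds for the potential and the gain -/

section PotentialBounds

open scoped MatrixOrder Matrix.Norms.L2Operator

variable {ν : Type*} [Fintype ν] [DecidableEq ν]

lemma log_det_le_trace {X : Matrix ν ν ℝ} (hX : X.PosDef) : Real.log X.det ≤ X.trace := by
  rw [hX.1.det_eq_prod_eigenvalues, hX.1.trace_eq_sum_eigenvalues]
  simp only [RCLike.ofReal_real_eq_id, id]
  rw [Real.log_prod fun i _ => (hX.eigenvalues_pos i).ne']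
  refine Finset.sum_le_sum fun i _ => ?_
  have := Real.log_le_sub_one_of_pos (hX.eigenvalues_pos i)
  linarith

/-- With `W⁻¹ = Cᵀ C`, the potential of `B` is that of `C B Cᵀ` with respect to the identity,
up to a constant. -/
lemma exists_le_potential {W : Matrix ν ν ℝ} (hW : W.PosDef) :
    ∃ l : ℝ, ∀ B : Matrix ν ν ℝ, B.PosDef → l ≤ potential W B := by
  obtain ⟨C, hC⟩ := CStarAlgebra.nonneg_iff_eq_star_mul_self.1 hW.inv.posSemidef.nonneg
  rw [star_eq_conjTranspose, conjTranspose_eq_transpose_of_trivial] at hC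
  have hdetC : W⁻¹.det = C.det * C.det := by rw [hC, det_mul, det_transpose]
  have hC0 : C.det ≠ 0 := fun h => by
    have := hW.inv.det_pos
    rw [hdetC, h] at this
    simp at this
  refine ⟨Real.log (W⁻¹.det), fun B hB => ?_⟩
  have hinj : Function.Injective Cᵀ.mulVec :=
    mulVec_injective_of_isUnit ((isUnit_iff_isUnit_det _).2 (by rw [det_transpose]; exact hC0.isUnit))
  have hX : (Cᵀᵀ * B * Cᵀ).PosDef := by
    have := hB.conjTranspose_mul_mul_same hinj
    rwa [conjTranspose_eq_transpose_of_trivial] at this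
  have h := log_det_le_trace hX
  rw [transpose_transpose, det_mul, det_mul, det_transpose,
    show C.det * B.det * C.det = W⁻¹.det * B.det by rw [hdetC]; ring,
    Real.log_mul hW.inv.det_pos.ne' hB.det_pos.ne', Matrix.mul_assoc, trace_mul_comm,
    Matrix.mul_assoc, trace_mul_comm, ← hC] at h
  rw [potential]
  linarith

lemma sub_inv_quadratic {W : Matrix ν ν ℝ} (hW : W.PosDef) (B : Matrix ν ν ℝ) (v : ν → ℝ) :
    (B *ᵥ v - W *ᵥ v) ⬝ᵥ W⁻¹ *ᵥ (B *ᵥ v - W *ᵥ v)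
      = (B *ᵥ v) ⬝ᵥ W⁻¹ *ᵥ (B *ᵥ v) - 2 * (v ⬝ᵥ B *ᵥ v) + v ⬝ᵥ W *ᵥ v := by
  have hdet : IsUnit W.det := hW.det_pos.ne'.isUnit
  have hWi := (posDef_iff_real.1 hW.inv).1
  have h1 : W⁻¹ *ᵥ (W *ᵥ v) = v := by rw [mulVec_mulVec, nonsing_inv_mul _ hdet, one_mulVec]
  have h2 : (W *ᵥ v) ⬝ᵥ W⁻¹ *ᵥ (B *ᵥ v) = v ⬝ᵥ B *ᵥ v := by
    rw [dotProduct_mulVec_comm_of_symm hWi, h1, dotProduct_comm]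
  simp only [mulVec_sub, sub_dotProduct, dotProduct_sub, h1, h2]
  rw [dotProduct_comm (B *ᵥ v) v, dotProduct_comm (W *ᵥ v) v]
  ring

/-- A small gain forces `B v` to be close to `W v`. -/
lemma sub_inv_quadratic_le_of_gain_le {W B : Matrix ν ν ℝ} (hW : W.PosDef) (hB : B.PosDef)
    {v : ν → ℝ} (hv : v ≠ 0) {δ : ℝ} (hδ : δ ≤ 1) (hg : gain W B v ≤ δ) :
    (B *ᵥ v - W *ᵥ v) ⬝ᵥ W⁻¹ *ᵥ (B *ᵥ v - W *ᵥ v) ≤ 13 * δ * (v ⬝ᵥ W *ᵥ v) := by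
  rw [sub_inv_quadratic hW]
  have hcs := sq_dotProduct_le_inv hW v (B *ᵥ v)
  have ha := (posDef_iff_real.1 hB).2 v hv
  have hN := (posDef_iff_real.1 hW).2 v hv
  rw [gain] at hg
  set a := v ⬝ᵥ B *ᵥ v
  set N := v ⬝ᵥ W *ᵥ v
  set b := (B *ᵥ v) ⬝ᵥ W⁻¹ *ᵥ (B *ᵥ v)
  set t := a / N with ht
  set u := b / a with hu
  have hta : a = t * N := by rw [ht]; field_simp
  have hub : b = u * a := by rw [hu]; field_simp
  have htpos : 0 < t := by positivity
  have htu : t ≤ u := by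
    rw [ht, hu, div_le_div_iff₀ hN ha]; nlinarith
  -- `(√t - 1)² ≤ t - 1 - log t`, as `log t = 2 log √t ≤ 2 (√t - 1)`
  set r := Real.sqrt t with hr
  have hrpos : 0 < r := Real.sqrt_pos.2 htpos
  have hrt : t = r ^ 2 := (Real.sq_sqrt htpos.le).symm
  have hlog : Real.log t ≤ 2 * (r - 1) := by
    rw [hrt, Real.log_pow]
    push_cast
    have := Real.log_le_sub_one_of_pos hrpos
    linarith
  have h1 : (r - 1) ^ 2 ≤ δ := by nlinarith
  have h2 : r ≤ 2 := by nlinarith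
  have h3 : u - t ≤ δ := by
    have := Real.log_le_sub_one_of_pos htpos
    linarith
  have hδ0 : 0 ≤ δ := le_trans (sq_nonneg _) h1
  have h4 : (t - 1) ^ 2 ≤ 9 * δ := by
    have : (t - 1) ^ 2 = (r - 1) ^ 2 * (r + 1) ^ 2 := by rw [hrt]; ring
    have h5 : (r + 1) ^ 2 ≤ 9 := by nlinarith
    rw [this]
    nlinarith [sq_nonneg (r - 1), sq_nonneg (r + 1)]
  have h5 : t ≤ 4 := by nlinarith
  have h6 : u * t - 2 * t + 1 ≤ 13 * δ := by nlinarith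
  have h7 : b - 2 * a + N = (u * t - 2 * t + 1) * N := by rw [hub, hta]; ring
  rw [h7]
  exact mul_le_mul_of_nonneg_right h6 hN.le

/-- The gain of a matrix `G` close to `W` is small, even of second order in the distance. -/
lemma gain_le_of_near {W G : Matrix ν ν ℝ} (hW : W.PosDef)
    {v : ν → ℝ} (hv : v ≠ 0) {δ : ℝ} (hδ : δ ≤ 1 / 2)
    (h1 : |v ⬝ᵥ G *ᵥ v - v ⬝ᵥ W *ᵥ v| ≤ δ * (v ⬝ᵥ W *ᵥ v))
    (h2 : (G *ᵥ v - W *ᵥ v) ⬝ᵥ W⁻¹ *ᵥ (G *ᵥ v - W *ᵥ v) ≤ δ ^ 2 * (v ⬝ᵥ W *ᵥ v)) :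
    gain W G v ≤ 2 * δ ^ 2 := by
  rw [sub_inv_quadratic hW] at h2
  have hN := (posDef_iff_real.1 hW).2 v hv
  rw [gain]
  set a := v ⬝ᵥ G *ᵥ v
  set N := v ⬝ᵥ W *ᵥ v
  set b := (G *ᵥ v) ⬝ᵥ W⁻¹ *ᵥ (G *ᵥ v)
  obtain ⟨h3, h4⟩ := abs_le.1 h1
  have ha2 : N / 2 ≤ a := by nlinarith
  have ha : 0 < a := by linarith
  have hlog := Real.log_le_sub_one_of_pos (div_pos hN ha)
  rw [Real.log_div hN.ne' ha.ne'] at hlog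
  rw [Real.log_div ha.ne' hN.ne']
  have h5 : b / a + N / a - 2 ≤ 2 * δ ^ 2 := by
    rw [← add_div, sub_le_iff_le_add, div_le_iff₀ ha]
    nlinarith [sq_nonneg δ]
  linarith

end PotentialBounds

/-! ### The factorization `L Σ Lᵀ` -/

section Factorization

lemma sum_subtype_lt {p : ℕ} (j : Fin p) (F : Fin p → ℝ) :
    ∑ l : {l : Fin p // l < j}, F l.1 = ∑ l, if l < j then F l else 0 := by
  rw [← Finset.sum_filter]
  exact (Finset.sum_subtype _ (by simp) F).symm

lemma ldl_fst {p : ℕ} (A : Matrix (Fin p) (Fin p) ℝ) (j : Fin p) :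
    (ldl A j).1 = A j j - ∑ l, if l < j then (ldl A l).2 j ^ 2 * (ldl A l).1 else 0 := by
  rw [ldl, ← sum_subtype_lt j fun l => (ldl A l).2 j ^ 2 * (ldl A l).1]

lemma ldl_snd {p : ℕ} (A : Matrix (Fin p) (Fin p) ℝ) (j i : Fin p) :
    (ldl A j).2 i = if i < j then 0 else if i = j then 1 else
      (A i j - ∑ l, if l < j then (ldl A l).2 j * (ldl A l).2 i * (ldl A l).1 else 0)
        / (ldl A j).1 := by
  rw [ldl_fst, ldl]
  simp only
  rw [← sum_subtype_lt j fun l => (ldl A l).2 j * (ldl A l).2 i * (ldl A l).1,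
    ← sum_subtype_lt j fun l => (ldl A l).2 j ^ 2 * (ldl A l).1]

/-- The factorization of a leading principal block is the leading part of the factorization. -/
lemma ldl_castSucc {p : ℕ} (A : Matrix (Fin (p + 1)) (Fin (p + 1)) ℝ)
    (A' : Matrix (Fin p) (Fin p) ℝ) (h : ∀ i j, A' i j = A i.castSucc j.castSucc) (j : Fin p) :
    (ldl A j.castSucc).1 = (ldl A' j).1 ∧
      ∀ i : Fin p, (ldl A j.castSucc).2 i.castSucc = (ldl A' j).2 i := by
  induction j using WellFoundedLT.induction with
  | ind j ih =>
    have h1 : (ldl A j.castSucc).1 = (ldl A' j).1 := by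
      rw [ldl_fst, ldl_fst, Fin.sum_univ_castSucc, h,
        if_neg (not_lt.2 (Fin.le_last _)), add_zero]
      congr 1
      refine Finset.sum_congr rfl fun l _ => ?_
      simp only [Fin.castSucc_lt_castSucc_iff]
      split_ifs with hl
      · rw [(ih l hl).1, (ih l hl).2]
      · rfl
    refine ⟨h1, fun i => ?_⟩
    rw [ldl_snd, ldl_snd, h1, Fin.sum_univ_castSucc, h,
        if_neg (not_lt.2 (Fin.le_last _)), add_zero]
    simp only [Fin.castSucc_lt_castSucc_iff, Fin.castSucc_inj]
    congr 4
    refine Finset.sum_congr rfl fun l _ => ?_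
    split_ifs with hl
    · rw [(ih l hl).1, (ih l hl).2, (ih l hl).2]
    · rfl

/-- The identity `A = L Σ Lᵀ`, valid as long as no pivot but the last vanishes. -/
lemma ldl_factorization {p : ℕ} {A : Matrix (Fin (p + 1)) (Fin (p + 1)) ℝ} (hA : Aᵀ = A)
    (hne : ∀ l : Fin p, (ldl A l.castSucc).1 ≠ 0) (i j : Fin (p + 1)) :
    A i j = ∑ l, (ldl A l).2 i * (ldl A l).2 j * (ldl A l).1 := by
  have main : ∀ i j : Fin (p + 1), j ≤ i →
      A i j = ∑ l, (ldl A l).2 i * (ldl A l).2 j * (ldl A l).1 := by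
    intro i j hji
    have hsplit : ∑ l, (ldl A l).2 i * (ldl A l).2 j * (ldl A l).1
        = (∑ l, if l < j then (ldl A l).2 j * (ldl A l).2 i * (ldl A l).1 else 0)
          + (ldl A j).2 i * (ldl A j).1 := by
      have h1 : (ldl A j).2 i * (ldl A j).1
          = ∑ l, if l = j then (ldl A l).2 i * (ldl A l).1 else 0 := by simp
      rw [h1, ← Finset.sum_add_distrib]
      refine Finset.sum_congr rfl fun l _ => ?_
      rcases lt_trichotomy l j with hl | rfl | hl
      · simp only [hl, hl.ne, if_true, if_false, add_zero]; ring
      · have : (ldl A l).2 l = 1 := by rw [ldl_snd]; simp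
        simp [this]
      · have : (ldl A l).2 j = 0 := by rw [ldl_snd]; simp [hl]
        simp [this, hl.ne', hl.not_gt]
    rw [hsplit]
    rcases hji.eq_or_lt with rfl | hlt
    · have : (ldl A j).2 j = 1 := by rw [ldl_snd]; simp
      rw [this, one_mul, ldl_fst]
      simp only [pow_two]
      ring
    · have hj : (ldl A j).1 ≠ 0 := by
        obtain ⟨l, rfl⟩ : ∃ l : Fin p, l.castSucc = j :=
          Fin.exists_castSucc_eq.2 (ne_of_lt (lt_of_lt_of_le hlt (Fin.le_last _)))
        exact hne l
      conv_rhs => enter [2, 1]; rw [ldl_snd]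
      rw [if_neg hlt.not_gt, if_neg hlt.ne', div_mul_cancel₀ _ hj]
      ring
  rcases le_total j i with h | h
  · exact main i j h
  · rw [show A i j = A j i from congrFun (congrFun hA j) i, main j i h]
    exact Finset.sum_congr rfl fun l _ => by ring

/-- The last pivot is at most the value of the quadratic form at a vector with last
coordinate `1`. -/
lemma ldl_last_mul_sq_le {p : ℕ} {A : Matrix (Fin (p + 1)) (Fin (p + 1)) ℝ} (hA : Aᵀ = A)
    (hpos : ∀ l : Fin p, 0 < (ldl A l.castSucc).1) (z : Fin (p + 1) → ℝ) :
    (ldl A (Fin.last p)).1 * z (Fin.last p) ^ 2 ≤ z ⬝ᵥ A *ᵥ z := by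
  have h1 : z ⬝ᵥ A *ᵥ z = ∑ l, (ldl A l).1 * (∑ i, (ldl A l).2 i * z i) ^ 2 := by
    have h2 : z ⬝ᵥ A *ᵥ z
        = ∑ i, ∑ j, ∑ l, (ldl A l).1 * ((ldl A l).2 i * z i) * ((ldl A l).2 j * z j) := by
      simp only [dotProduct, mulVec, Finset.mul_sum]
      refine Finset.sum_congr rfl fun i _ => Finset.sum_congr rfl fun j _ => ?_
      rw [ldl_factorization hA (fun l => (hpos l).ne') i j, Finset.sum_mul, Finset.mul_sum]
      exact Finset.sum_congr rfl fun l _ => by ring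
    rw [h2]
    have h3 : ∀ l, (ldl A l).1 * (∑ i, (ldl A l).2 i * z i) ^ 2
        = ∑ i, ∑ j, (ldl A l).1 * ((ldl A l).2 i * z i) * ((ldl A l).2 j * z j) := fun l => by
      rw [pow_two, Finset.sum_mul_sum, Finset.mul_sum]
      refine Finset.sum_congr rfl fun i _ => ?_
      rw [Finset.mul_sum]
      exact Finset.sum_congr rfl fun j _ => by ring
    simp only [h3]
    rw [Finset.sum_comm]
    rw [Finset.sum_comm, Finset.sum_congr rfl fun i _ => Finset.sum_comm, Finset.sum_comm]
  rw [h1, Fin.sum_univ_castSucc]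
  have h4 : ∑ i, (ldl A (Fin.last p)).2 i * z i = z (Fin.last p) := by
    rw [Fin.sum_univ_castSucc, ldl_snd, if_neg (lt_irrefl _), if_pos rfl, one_mul]
    rw [Finset.sum_eq_zero, zero_add]
    intro i _
    rw [ldl_snd, if_pos (Fin.castSucc_lt_last i), zero_mul]
  rw [h4]
  have : 0 ≤ ∑ l : Fin p, (ldl A l.castSucc).1 * (∑ i, (ldl A l.castSucc).2 i * z i) ^ 2 :=
    Finset.sum_nonneg fun l _ => mul_nonneg (hpos l).le (sq_nonneg _)
  linarith

end Factorization

/-! ### The filtering procedure -/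

section Filtering

variable {n : ℕ}

/-- The matrix with columns `u 0, …, u (p - 1)`. -/
def columns {p : ℕ} (u : Fin p → EuclideanSpace ℝ (Fin n)) : Matrix (Fin n) (Fin p) ℝ :=
  Matrix.of fun a c => u c a

lemma columns_mulVec {p : ℕ} (u : Fin p → EuclideanSpace ℝ (Fin n)) (z : Fin p → ℝ) :
    columns u *ᵥ z = (∑ c, z c • u c).ofLp := by
  ext a
  simp [columns, mulVec, dotProduct, mul_comm]

/-- All pivots in the factorization of `Dᵀ G D` pass the test of the filtering procedure. -/
def PivotsPass {p : ℕ} (G : Matrix (Fin n) (Fin n) ℝ) (τ : ℝ)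
    (u : Fin p → EuclideanSpace ℝ (Fin n)) : Prop :=
  ∀ j, τ * ‖u j‖ ^ 2 ≤ (ldl ((columns u)ᵀ * G * columns u) j).1

lemma ldl_columns_castSucc {p : ℕ} (G : Matrix (Fin n) (Fin n) ℝ)
    (u : Fin (p + 1) → EuclideanSpace ℝ (Fin n)) (j : Fin p) :
    (ldl ((columns u)ᵀ * G * columns u) j.castSucc).1
      = (ldl ((columns fun i : Fin p => u i.castSucc)ᵀ * G
          * columns fun i : Fin p => u i.castSucc) j).1 :=
  (ldl_castSucc _ _ (fun i j => by simp [Matrix.mul_apply, columns]) j).1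

lemma pivotsPass_succ {p : ℕ} {G : Matrix (Fin n) (Fin n) ℝ} {τ : ℝ}
    {u : Fin (p + 1) → EuclideanSpace ℝ (Fin n)} :
    PivotsPass G τ u ↔ PivotsPass G τ (fun i : Fin p => u i.castSucc) ∧
      τ * ‖u (Fin.last p)‖ ^ 2 ≤ (ldl ((columns u)ᵀ * G * columns u) (Fin.last p)).1 := by
  constructor
  · intro h
    exact ⟨fun j => by rw [← ldl_columns_castSucc]; exact h j.castSucc, h _⟩
  · rintro ⟨h1, h2⟩ j
    refine Fin.lastCases h2 (fun j => ?_) j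
    rw [ldl_columns_castSucc]
    exact h1 j

lemma pivotsPass_append {ι : Type*} {G : Matrix (Fin n) (Fin n) ℝ} {τ : ℝ}
    {s : ι → EuclideanSpace ℝ (Fin n)} {kept : List ι} {i : ι}
    (h : PivotsPass G τ fun c => s (kept.get c)) (hi : τ * ‖s i‖ ^ 2 ≤ pivot G s kept i) :
    PivotsPass G τ fun c => s ((kept ++ [i]).get c) := by
  have gen : ∀ (p : ℕ) (hp : p = kept.length + 1) (u : Fin p → EuclideanSpace ℝ (Fin n)),
      (∀ c : Fin kept.length, u (Fin.cast hp.symm c.castSucc) = s (kept.get c)) →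
      u (Fin.cast hp.symm (Fin.last _)) = s i →
      τ * ‖s i‖ ^ 2 ≤ (ldl ((columns u)ᵀ * G * columns u) (Fin.cast hp.symm (Fin.last _))).1 →
      PivotsPass G τ u := by
    rintro p rfl u h1 h2 h3
    refine pivotsPass_succ.2 ⟨?_, ?_⟩
    · simpa only [Fin.cast_refl, id] using (funext h1 : (fun c : Fin kept.length => u _) = _) ▸ h
    · simp only [Fin.cast_refl, id] at h2 h3
      rw [h2]; exact h3
  refine gen _ (by simp) _ (fun c => ?_) ?_ hi
  · simp
  · simp

lemma pivotsPass_filterLoop {ι : Type*} {G : Matrix (Fin n) (Fin n) ℝ} {τ : ℝ}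
    {s : ι → EuclideanSpace ℝ (Fin n)} (rest : List ι) : ∀ kept : List ι,
    (PivotsPass G τ fun c => s (kept.get c)) →
    PivotsPass G τ fun c => s ((filterLoop G τ s kept rest).get c) := by
  induction rest with
  | nil => intro kept h; simpa [filterLoop] using h
  | cons i rest ih =>
    intro kept h
    by_cases hi : τ * ‖s i‖ ^ 2 ≤ pivot G s kept i
    · have e : filterLoop G τ s kept (i :: rest) = filterLoop G τ s (kept ++ [i]) rest := by
        rw [filterLoop, if_pos hi]
      rw [e]
      exact ih _ (pivotsPass_append h hi)
    · have e : filterLoop G τ s kept (i :: rest) = filterLoop G τ s kept rest := by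
        rw [filterLoop, if_neg hi]
      rw [e]
      exact ih _ h

lemma pivotsPass_filterSteps {ι : Type*} (G : Matrix (Fin n) (Fin n) ℝ) (τ : ℝ)
    (s : ι → EuclideanSpace ℝ (Fin n)) (J : List ι) :
    PivotsPass G τ fun c => s ((filterSteps G τ s J).get c) :=
  pivotsPass_filterLoop J [] fun j => j.elim0

lemma filterLoop_ne_nil {ι : Type*} {G : Matrix (Fin n) (Fin n) ℝ} {τ : ℝ}
    {s : ι → EuclideanSpace ℝ (Fin n)} (rest : List ι) : ∀ kept : List ι, kept ≠ [] →
    filterLoop G τ s kept rest ≠ [] := by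
  induction rest with
  | nil => intro kept h; simpa [filterLoop] using h
  | cons i rest ih =>
    intro kept h
    rw [filterLoop]
    split_ifs with hi
    · exact ih _ (by simp)
    · exact ih _ h

lemma pivot_nil {ι : Type*} (G : Matrix (Fin n) (Fin n) ℝ)
    (s : ι → EuclideanSpace ℝ (Fin n)) (i : ι) :
    pivot G s [] i = (s i).ofLp ⬝ᵥ G *ᵥ (s i).ofLp := by
  rw [pivot, ldl_fst]
  simp [Matrix.mul_apply, colMatrix, dotProduct, mulVec, Finset.sum_mul, Finset.mul_sum]
  rw [Finset.sum_comm]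
  exact Finset.sum_congr rfl fun _ _ => Finset.sum_congr rfl fun _ _ => by ring

/-- Where the Hessian is bounded below by `τ`, the first step examined is always retained. -/
lemma filterSteps_ne_nil {ι : Type*} {G : Matrix (Fin n) (Fin n) ℝ} {τ : ℝ}
    {s : ι → EuclideanSpace ℝ (Fin n)} {J : List ι} (hJ : J ≠ [])
    (hG : ∀ v : EuclideanSpace ℝ (Fin n), τ * ‖v‖ ^ 2 ≤ v.ofLp ⬝ᵥ G *ᵥ v.ofLp) :
    filterSteps G τ s J ≠ [] := by
  obtain ⟨i, rest, rfl⟩ := List.exists_cons_of_ne_nil hJ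
  rw [filterSteps, filterLoop, if_pos (by rw [pivot_nil]; exact hG _)]
  exact filterLoop_ne_nil _ _ (by simp)

/-- The filtering procedure bounds the Hessian from below on the span of the retained steps:
if all pivots pass the test, then `vᵀ G v ≥ c ‖v‖²` for all `v = D z`, with a constant which
depends only on `τ`, the upper bound `M` of `G`, and the number of columns. -/
lemma exists_coercive_of_pivotsPass {τ M : ℝ} (hτ : 0 < τ) (hM : 0 < M) (p : ℕ) :
    ∃ c : ℝ, 0 < c ∧ ∀ (G : Matrix (Fin n) (Fin n) ℝ) (u : Fin p → EuclideanSpace ℝ (Fin n)),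
      Gᵀ = G → (∀ v : EuclideanSpace ℝ (Fin n), 0 ≤ v.ofLp ⬝ᵥ G *ᵥ v.ofLp) →
      (∀ v : EuclideanSpace ℝ (Fin n), v.ofLp ⬝ᵥ G *ᵥ v.ofLp ≤ M * ‖v‖ ^ 2) →
      (∀ j, u j ≠ 0) → PivotsPass G τ u →
      ∀ z : Fin p → ℝ, c * ‖∑ j, z j • u j‖ ^ 2
          ≤ (columns u *ᵥ z) ⬝ᵥ G *ᵥ (columns u *ᵥ z) ∧
        (∑ j, z j • u j = 0 → z = 0) := by
  induction p with
  | zero =>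
    refine ⟨1, one_pos, fun G u _ _ _ _ _ z => ⟨?_, fun _ => Subsingleton.elim _ _⟩⟩
    rw [columns_mulVec]
    simp
  | succ p ih =>
    obtain ⟨c, hc, ih⟩ := ih
    refine ⟨(2 * (2 + 2 * M / τ) / c + 2 / τ)⁻¹, by positivity, fun G u hs h0 hM' hu hP z => ?_⟩
    obtain ⟨hP1, hP2⟩ := pivotsPass_succ.1 hP
    obtain ⟨ih1, ih2⟩ := ih G _ hs h0 hM' (fun j => hu j.castSucc) hP1 fun j => z j.castSucc
    set w : EuclideanSpace ℝ (Fin n) := ∑ j : Fin p, z j.castSucc • u j.castSucc with hw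
    set y : EuclideanSpace ℝ (Fin n) := z (Fin.last p) • u (Fin.last p) with hy
    have hpos : ∀ l : Fin p, 0 < (ldl ((columns u)ᵀ * G * columns u) l.castSucc).1 := fun l => by
      have h1 : 0 < ‖u l.castSucc‖ := norm_pos_iff.2 (hu _)
      exact lt_of_lt_of_le (by positivity) (hP l.castSucc)
    have hlast := ldl_last_mul_sq_le (A := (columns u)ᵀ * G * columns u)
      (by simp [transpose_mul, hs, Matrix.mul_assoc]) hpos z
    have hgram : z ⬝ᵥ ((columns u)ᵀ * G * columns u) *ᵥ z
        = (columns u *ᵥ z) ⬝ᵥ G *ᵥ (columns u *ᵥ z) := by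
      rw [← mulVec_mulVec, ← mulVec_mulVec, dotProduct_mulVec, vecMul_transpose]
    have hsum : ∑ j, z j • u j = w + y := Fin.sum_univ_castSucc _
    rw [hgram] at hlast
    rw [columns_mulVec] at hlast ih1 ⊢
    rw [hsum] at hlast ⊢
    rw [← hw] at ih1
    -- the component `y` along the last column is controlled by the last pivot
    have hy1 : τ * ‖y‖ ^ 2 ≤ (w + y).ofLp ⬝ᵥ G *ᵥ (w + y).ofLp := by
      refine le_trans ?_ hlast
      rw [hy, norm_smul, mul_pow, Real.norm_eq_abs, sq_abs]
      nlinarith [sq_nonneg (z (Fin.last p))]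
    constructor
    · have hq : w.ofLp ⬝ᵥ G *ᵥ w.ofLp ≤ 2 * ((w + y).ofLp ⬝ᵥ G *ᵥ (w + y).ofLp)
          + 2 * (y.ofLp ⬝ᵥ G *ᵥ y.ofLp) := by
        have := h0 (w + y + y)
        simp only [WithLp.ofLp_add, mulVec_add, add_dotProduct, dotProduct_add] at this ⊢
        linarith
      have hMy := hM' y
      set Q := (w + y).ofLp ⬝ᵥ G *ᵥ (w + y).ofLp
      have e1 : ‖y‖ ^ 2 ≤ Q / τ := by rw [le_div_iff₀ hτ]; linarith
      have e2 : ‖w‖ ^ 2 ≤ (2 + 2 * M / τ) * Q / c := by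
        rw [le_div_iff₀ hc]
        have : M * ‖y‖ ^ 2 ≤ M * (Q / τ) := mul_le_mul_of_nonneg_left e1 hM.le
        have e3 : (2 + 2 * M / τ) * Q = 2 * Q + 2 * (M * (Q / τ)) := by ring
        rw [e3]
        linarith
      have e3 : ‖w + y‖ ^ 2 ≤ 2 * ‖w‖ ^ 2 + 2 * ‖y‖ ^ 2 := by
        have := norm_add_le w y
        nlinarith [norm_nonneg (w + y), sq_nonneg (‖w‖ - ‖y‖)]
      rw [inv_mul_le_iff₀ (by positivity)]
      have e4 : (2 * (2 + 2 * M / τ) / c + 2 / τ) * Q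
          = 2 * ((2 + 2 * M / τ) * Q / c) + 2 * (Q / τ) := by ring
      rw [e4]
      linarith
    · intro hv
      rw [hv] at hy1
      simp only [WithLp.ofLp_zero, mulVec_zero, dotProduct_zero] at hy1
      have hy0 : y = 0 := by
        have : ‖y‖ ^ 2 ≤ 0 := by nlinarith
        simpa using le_antisymm this (sq_nonneg _)
      have hz := ih2 (by rwa [hy0, add_zero] at hv)
      have hz' : z (Fin.last p) = 0 := (smul_eq_zero.1 hy0).resolve_right (hu _)
      ext j
      refine Fin.lastCases hz' (fun j => ?_) j
      exact congrFun hz j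

end Filtering

/-! ### Convex functions and their gradients -/

section Calculus

variable {F : Type*} [NormedAddCommGroup F] [InnerProductSpace ℝ F]

lemma hasDerivAt_line (x v : F) (t : ℝ) : HasDerivAt (fun t : ℝ => x + t • v) v t := by
  simpa using ((hasDerivAt_id t).smul_const v).const_add x

variable {f : F → ℝ}

/-- Linear growth of a convex function away from its minimizer. -/
lemma growth_far (hc : ConvexOn ℝ Set.univ f) {xs : F} {c r : ℝ} (hr : 0 < r)
    (hnear : ∀ z, ‖z - xs‖ ≤ r → c * ‖z - xs‖ ^ 2 ≤ f z - f xs) {x : F} (hx : r ≤ ‖x - xs‖) :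
    c * r * ‖x - xs‖ ≤ f x - f xs := by
  set D := ‖x - xs‖ with hD
  have hDpos : 0 < D := hr.trans_le hx
  set z : F := (1 - r / D) • xs + (r / D) • x with hz
  have hzx : z - xs = (r / D) • (x - xs) := by rw [hz]; module
  have hnz : ‖z - xs‖ = r := by
    rw [hzx, norm_smul, Real.norm_of_nonneg (by positivity), ← hD]
    field_simp
  have h1 := hnear z hnz.le
  have hle : r / D ≤ 1 := (div_le_one hDpos).2 hx
  have h2 := hc.2 (Set.mem_univ xs) (Set.mem_univ x) (sub_nonneg.2 hle)
    (by positivity : 0 ≤ r / D) (by ring)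
  rw [← hz, smul_eq_mul, smul_eq_mul] at h2
  rw [hnz] at h1
  have h3 : c * r ^ 2 ≤ r / D * (f x - f xs) := by linarith
  have h4 : c * r ^ 2 * D ≤ r * (f x - f xs) := by
    have := mul_le_mul_of_nonneg_right h3 hDpos.le
    calc _ ≤ _ := this
      _ = _ := by field_simp
  have : r * (c * r * D) ≤ r * (f x - f xs) := by linarith
  exact le_of_mul_le_mul_left this hr

variable [CompleteSpace F]

lemma hasDerivAt_comp_line (hd : Differentiable ℝ f) (x v : F) (t : ℝ) :
    HasDerivAt (fun t : ℝ => f (x + t • v)) (inner ℝ (gradient f (x + t • v)) v) t := by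
  have := (hd (x + t • v)).hasGradientAt.hasFDerivAt.comp_hasDerivAt t (hasDerivAt_line x v t)
  exact this.congr_deriv (by simp)

lemma hasDerivAt_inner_gradient (h2 : Differentiable ℝ (gradient f)) (x v w : F) (t : ℝ) :
    HasDerivAt (fun t : ℝ => inner ℝ (gradient f (x + t • v)) w)
      (inner ℝ (fderiv ℝ (gradient f) (x + t • v) v) w) t := by
  have h := (h2 (x + t • v)).hasFDerivAt.comp_hasDerivAt t (hasDerivAt_line x v t)
  have := h.inner ℝ (hasDerivAt_const t w)
  simpa using this

lemma add_inner_gradient_le (hc : ConvexOn ℝ Set.univ f) (hd : Differentiable ℝ f) (x y : F) :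
    f x + inner ℝ (gradient f x) (y - x) ≤ f y := by
  have hline : ConvexOn ℝ Set.univ fun t : ℝ => f (x + t • (y - x)) := by
    refine ⟨convex_univ, fun a _ b _ p q hp hq hpq => ?_⟩
    have := hc.2 (Set.mem_univ (x + a • (y - x))) (Set.mem_univ (x + b • (y - x))) hp hq hpq
    obtain rfl : q = 1 - p := by linarith
    refine le_of_eq_of_le (congrArg f ?_) this
    simp only [smul_eq_mul]
    module
  have := hline.le_slope_of_hasDerivAt (Set.mem_univ 0) (Set.mem_univ 1) one_pos
    (hasDerivAt_comp_line hd x (y - x) 0)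
  simp only [slope_def_field, zero_smul, add_zero, one_smul, add_sub_cancel, sub_zero,
    div_one] at this
  linarith

lemma inner_gradient_sub_nonneg (hc : ConvexOn ℝ Set.univ f) (hd : Differentiable ℝ f) (x y : F) :
    0 ≤ inner ℝ (gradient f y - gradient f x) (y - x) := by
  have h1 := add_inner_gradient_le hc hd x y
  have h2 := add_inner_gradient_le hc hd y x
  rw [← neg_sub y x, inner_neg_right] at h2
  rw [inner_sub_left]
  linarith

lemma inner_fderiv_gradient_nonneg (hc : ConvexOn ℝ Set.univ f) (hd : Differentiable ℝ f)
    (h2 : Differentiable ℝ (gradient f)) (x v : F) :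
    0 ≤ inner ℝ (fderiv ℝ (gradient f) x v) v := by
  have h := hasDerivAt_iff_tendsto_slope_zero.1 (hasDerivAt_inner_gradient h2 x v v 0)
  rw [zero_smul, add_zero] at h
  refine ge_of_tendsto h (eventually_nhdsWithin_of_forall fun t ht => ?_)
  have ht0 : t ≠ 0 := ht
  have h3 := inner_gradient_sub_nonneg hc hd x (x + t • v)
  rw [add_sub_cancel_left, inner_smul_right, inner_sub_left] at h3
  rw [zero_add, smul_eq_mul]
  have : t⁻¹ * (inner ℝ (gradient f (x + t • v)) v - inner ℝ (gradient f x) v)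
      = (t⁻¹) ^ 2 * (t * (inner ℝ (gradient f (x + t • v)) v - inner ℝ (gradient f x) v)) := by
    field_simp
  rw [this]
  positivity

lemma inner_fderiv_gradient_comm (hd : Differentiable ℝ f)
    (h2 : Differentiable ℝ (gradient f)) (x v w : F) :
    inner ℝ (fderiv ℝ (gradient f) x v) w = inner ℝ (fderiv ℝ (gradient f) x w) v := by
  have h := second_derivative_symmetric (𝕜 := ℝ) (f := f)
    (f' := fun y => InnerProductSpace.toDual ℝ F (gradient f y))
    (f'' := (InnerProductSpace.toDual ℝ F).toContinuousLinearEquiv.toContinuousLinearMap.comp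
      (fderiv ℝ (gradient f) x)) (x := x)
    (fun y => (hd y).hasGradientAt.hasFDerivAt)
    ((InnerProductSpace.toDual ℝ F).toContinuousLinearEquiv.toContinuousLinearMap.hasFDerivAt.comp
      x (h2 x).hasFDerivAt) v w
  simpa using h

/-- The mean value theorem for the gradient, tested against the increment. -/
lemma exists_inner_gradient_sub (h2 : Differentiable ℝ (gradient f)) (x y : F) :
    ∃ ξ ∈ segment ℝ x y, inner ℝ (gradient f y - gradient f x) (y - x)
      = inner ℝ (fderiv ℝ (gradient f) ξ (y - x)) (y - x) := by
  have hd := hasDerivAt_inner_gradient h2 x (y - x) (y - x)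
  obtain ⟨t, ht, h⟩ := exists_hasDerivAt_eq_slope _ _ one_pos
    (fun t _ => (hd t).continuousAt.continuousWithinAt) fun t _ => hd t
  refine ⟨x + t • (y - x), ?_, ?_⟩
  · rw [segment_eq_image']
    exact ⟨t, ⟨ht.1.le, ht.2.le⟩, rfl⟩
  · rw [h]
    simp [inner_sub_left]

/-- Growth of a convex function near a minimizer, under a lower bound of the Hessian: compare the
values at `z` and at the midpoint of `z` and the minimizer. -/
lemma growth_of_le_hessian (hc : ConvexOn ℝ Set.univ f) (hd : Differentiable ℝ f)
    (h2 : Differentiable ℝ (gradient f)) {xs : F} (hmin : ∀ y, f xs ≤ f y)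
    (hg : gradient f xs = 0) {m r : ℝ}
    (hm : ∀ y, ‖y - xs‖ ≤ r → ∀ v, m * ‖v‖ ^ 2 ≤ inner ℝ (fderiv ℝ (gradient f) y v) v)
    {z : F} (hz : ‖z - xs‖ ≤ r) :
    m * ‖z - xs‖ ^ 2 ≤ inner ℝ (gradient f z) (z - xs) ∧
      m / 4 * ‖z - xs‖ ^ 2 ≤ f z - f xs := by
  have key : ∀ z : F, ‖z - xs‖ ≤ r →
      m * ‖z - xs‖ ^ 2 ≤ inner ℝ (gradient f z) (z - xs) := by
    intro z hz
    obtain ⟨ξ, hξ, h⟩ := exists_inner_gradient_sub h2 xs z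
    rw [hg, sub_zero] at h
    rw [h]
    refine hm ξ ?_ _
    have := (convex_closedBall xs r).segment_subset
      (Metric.mem_closedBall_self ((norm_nonneg _).trans hz)) (mem_closedBall_iff_norm.2 hz) hξ
    exact mem_closedBall_iff_norm.1 this
  refine ⟨key z hz, ?_⟩
  set w : F := xs + (1 / 2 : ℝ) • (z - xs) with hw
  have hwx : w - xs = (1 / 2 : ℝ) • (z - xs) := by rw [hw]; abel
  have hzw : z - w = (1 / 2 : ℝ) • (z - xs) := by
    have : z - w = (z - xs) - (w - xs) := by abel
    rw [this, hwx]
    module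
  have hnw : ‖w - xs‖ = 1 / 2 * ‖z - xs‖ := by
    rw [hwx, norm_smul]; norm_num
  have h1 := key w (by rw [hnw]; linarith [norm_nonneg (z - xs)])
  have h3 := add_inner_gradient_le hc hd w z
  rw [hzw, ← hwx] at h3
  rw [hnw] at h1
  have := hmin w
  nlinarith

end Calculus

/-! ### Admissibility of the unit step near the minimizer -/

section LocalAdmissibility

variable {n : ℕ} {f : EuclideanSpace ℝ (Fin n) → ℝ}

/-- Near a minimizer with positive definite Hessian `H`, the unit step is admissible for every
direction that solves the Newton equation `H d = - g(x)` with a small relative error. -/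
lemma exists_stepAdmissible_one (hd : Differentiable ℝ f) (h2 : Differentiable ℝ (gradient f))
    {xs : EuclideanSpace ℝ (Fin n)} (hg : gradient f xs = 0)
    (hcont : ContinuousAt (fderiv ℝ (gradient f)) xs) {m : ℝ} (hm : 0 < m)
    (hH : ∀ v, m * ‖v‖ ^ 2 ≤ inner ℝ (fderiv ℝ (gradient f) xs v) v)
    {α β : ℝ} (hα : α < 1 / 2) (hβ : 0 < β) :
    ∃ ε > 0, ∀ x d : EuclideanSpace ℝ (Fin n), ‖x - xs‖ < ε →
      ‖gradient f x + fderiv ℝ (gradient f) xs d‖ ≤ ε * ‖d‖ → StepAdmissible f α β x d 1 := by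
  set H := fderiv ℝ (gradient f) xs with hHdef
  -- a common bound for the relative errors of the Newton equation and of the Hessian
  obtain ⟨η, hη, hη1, hη2, hη3⟩ : ∃ η : ℝ, 0 < η ∧ η ≤ m / 2 ∧ 2 * η ≤ β * (m / 2) ∧
      2 * η ≤ (1 / 2 - α) * (m / 2) := by
    have h1 : 0 < 1 / 2 - α := by linarith
    refine ⟨min (m / 2) (min (β * (m / 2) / 2) ((1 / 2 - α) * (m / 2) / 2)), by positivity,
      min_le_left _ _, ?_, ?_⟩
    · have := (min_le_right (m / 2) _).trans
        (min_le_left (β * (m / 2) / 2) ((1 / 2 - α) * (m / 2) / 2))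
      linarith
    · have := (min_le_right (m / 2) _).trans
        (min_le_right (β * (m / 2) / 2) ((1 / 2 - α) * (m / 2) / 2))
      linarith
  obtain ⟨ρ, hρ, hball⟩ := Metric.continuousAt_iff.1 hcont η hη
  obtain ⟨ρ', hρ', hball'⟩ := Metric.continuousAt_iff.1 (h2 xs).continuousAt (m / 2 * (ρ / 2))
    (by positivity)
  refine ⟨min η (min (ρ / 2) ρ'), by positivity, fun x d hx hxd => ?_⟩
  have hxρ : ‖x - xs‖ < ρ / 2 := hx.trans_le ((min_le_right _ _).trans (min_le_left _ _))
  have hxρ' : ‖x - xs‖ < ρ' := hx.trans_le ((min_le_right _ _).trans (min_le_right _ _))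
  have hxd' : ‖gradient f x + H d‖ ≤ η * ‖d‖ :=
    hxd.trans (mul_le_mul_of_nonneg_right (min_le_left _ _) (norm_nonneg _))
  have hgx : ‖gradient f x‖ < m / 2 * (ρ / 2) := by
    have := hball' (by rwa [dist_eq_norm] : dist x xs < ρ')
    rwa [hg, dist_zero_right] at this
  -- the direction is small
  have hHd : m * ‖d‖ ≤ ‖H d‖ := by
    rcases eq_or_ne d 0 with rfl | hd0
    · simp
    · have h3 := (hH d).trans (real_inner_le_norm _ _)
      have : 0 < ‖d‖ := norm_pos_iff.2 hd0
      nlinarith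
  have hdρ : ‖d‖ < ρ / 2 := by
    have h3 : ‖H d‖ ≤ ‖gradient f x + H d‖ + ‖gradient f x‖ := by
      have := norm_sub_le (gradient f x + H d) (gradient f x)
      rwa [add_sub_cancel_left] at this
    have h4 : m / 2 * ‖d‖ ≤ ‖gradient f x‖ := by nlinarith [norm_nonneg d]
    have h5 : m / 2 * ‖d‖ < m / 2 * (ρ / 2) := by linarith
    exact lt_of_mul_lt_mul_left h5 (by positivity)
  -- the Hessian deviates from `H` by at most `η` on the ball that contains `x` and `x + d`
  have hmem : x ∈ Metric.ball xs ρ := by rw [mem_ball_iff_norm]; linarith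
  have hmem' : x + d ∈ Metric.ball xs ρ := by
    rw [mem_ball_iff_norm]
    have := norm_add_le (x - xs) d
    rw [show x + d - xs = x - xs + d by abel]
    linarith
  have hconv := convex_ball xs ρ
  have hgrad : ∀ y ∈ Metric.ball xs ρ,
      ‖gradient f y - gradient f x - H (y - x)‖ ≤ η * ‖y - x‖ := by
    intro y hy
    have := hconv.norm_image_sub_le_of_norm_hasFDerivWithin_le (𝕜 := ℝ)
      (f := fun y => gradient f y - H y) (f' := fun y => fderiv ℝ (gradient f) y - H) (C := η)
      (fun y _ => ((h2 y).hasFDerivAt.sub H.hasFDerivAt).hasFDerivWithinAt)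
      (fun y hy => by
        have := hball (Metric.mem_ball.1 hy)
        rw [dist_eq_norm] at this
        exact this.le) hmem hy
    simpa only [map_sub, sub_sub_sub_comm] using this
  have hsym : ∀ v w, inner ℝ (H v) w = inner ℝ (H w) v := inner_fderiv_gradient_comm hd h2 xs
  -- second order expansion of `f`
  have htaylor : |f (x + d) - f x - inner ℝ (gradient f x) d - 1 / 2 * inner ℝ (H d) d|
      ≤ η * ‖d‖ ^ 2 := by
    set φ : EuclideanSpace ℝ (Fin n) → ℝ := fun y =>
      f y - inner ℝ (gradient f x) y - 1 / 2 * inner ℝ (H (y - x)) (y - x) with hφ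
    have hφ' : ∀ y, HasFDerivAt φ (InnerProductSpace.toDual ℝ _
        (gradient f y - gradient f x - H (y - x))) y := by
      intro y
      have e1 := (hd y).hasGradientAt.hasFDerivAt
      have e2 := (innerSL ℝ (gradient f x)).hasFDerivAt (x := y)
      have e3 : HasFDerivAt (fun y => y - x) (ContinuousLinearMap.id ℝ _) y :=
        (hasFDerivAt_id y).sub_const x
      have e4 := ((H.hasFDerivAt.comp y e3).inner ℝ e3).const_mul (1 / 2)
      refine ((e1.sub e2).sub e4).congr_fderiv ?_
      ext v
      have e5 := hsym v (y - x)
      simp only [map_sub, inner_sub_left] at e5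
      simp [inner_sub_left]
      linarith
    have hseg : segment ℝ x (x + d) ⊆ Metric.ball xs ρ := hconv.segment_subset hmem hmem'
    have := (convex_segment x (x + d)).norm_image_sub_le_of_norm_hasFDerivWithin_le (𝕜 := ℝ)
      (f := φ) (C := η * ‖d‖) (fun y _ => (hφ' y).hasFDerivWithinAt)
      (fun y hy => by
        rw [LinearIsometryEquiv.norm_map]
        refine (hgrad y (hseg hy)).trans (mul_le_mul_of_nonneg_left ?_ hη.le)
        obtain ⟨t, ht, rfl⟩ := (segment_eq_image' ℝ x (x + d)) ▸ hy
        simp only [add_sub_cancel_left, norm_smul, Real.norm_of_nonneg ht.1]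
        exact mul_le_of_le_one_left (norm_nonneg _) ht.2)
      (left_mem_segment ℝ x (x + d)) (right_mem_segment ℝ x (x + d))
    rw [add_sub_cancel_left, Real.norm_eq_abs, mul_assoc, ← pow_two] at this
    refine le_of_eq_of_le ?_ this
    congr 1
    simp only [hφ, add_sub_cancel_left, inner_add_right, sub_self, inner_zero_right]
    ring
  have hnewton : |inner ℝ (gradient f x) d + inner ℝ (H d) d| ≤ η * ‖d‖ ^ 2 := by
    rw [← inner_add_left]
    refine (abs_real_inner_le_norm _ _).trans ?_
    nlinarith [norm_nonneg d]
  have hcurv : |inner ℝ (gradient f (x + d)) d - inner ℝ (gradient f x) d - inner ℝ (H d) d|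
      ≤ η * ‖d‖ ^ 2 := by
    rw [← inner_sub_left, ← inner_sub_left]
    refine (abs_real_inner_le_norm _ _).trans ?_
    have := hgrad _ hmem'
    rw [add_sub_cancel_left] at this
    nlinarith [norm_nonneg d]
  have hHd2 := hH d
  obtain ⟨t1, t2⟩ := abs_le.1 htaylor
  obtain ⟨n1, n2⟩ := abs_le.1 hnewton
  obtain ⟨c1, c2⟩ := abs_le.1 hcurv
  have hd2 : 0 ≤ ‖d‖ ^ 2 := sq_nonneg _
  have hgd : inner ℝ (gradient f x) d ≤ -(m / 2 * ‖d‖ ^ 2) := by nlinarith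
  refine ⟨?_, ?_⟩
  · rw [one_smul, mul_one]
    have h3 : (1 / 2 - α) * inner ℝ (gradient f x) d ≤ (1 / 2 - α) * -(m / 2 * ‖d‖ ^ 2) :=
      mul_le_mul_of_nonneg_left hgd (by linarith)
    have h4 := mul_le_mul_of_nonneg_right hη3 hd2
    linarith
  · rw [one_smul]
    have h3 : β * inner ℝ (gradient f x) d ≤ β * -(m / 2 * ‖d‖ ^ 2) :=
      mul_le_mul_of_nonneg_left hgd hβ.le
    have h4 := mul_le_mul_of_nonneg_right hη2 hd2
    linarith

end LocalAdmissibility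

/-! ### Matrices and Euclidean norms -/

section Translation

variable {n : ℕ}

lemma inner_eq_dotProduct (v w : EuclideanSpace ℝ (Fin n)) : inner ℝ v w = v.ofLp ⬝ᵥ w.ofLp := by
  rw [EuclideanSpace.inner_eq_star_dotProduct, star_trivial, dotProduct_comm]

lemma norm_sq_eq_dotProduct (v : EuclideanSpace ℝ (Fin n)) : ‖v‖ ^ 2 = v.ofLp ⬝ᵥ v.ofLp := by
  rw [← inner_eq_dotProduct, real_inner_self_eq_norm_sq]

lemma hessian_mulVec (f : EuclideanSpace ℝ (Fin n) → ℝ) (y v : EuclideanSpace ℝ (Fin n)) :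
    hessian f y *ᵥ v.ofLp = (fderiv ℝ (gradient f) y v).ofLp := by
  rw [← Matrix.ofLp_toEuclideanCLM, hessian, StarAlgEquiv.apply_symm_apply, hessianCLM]

lemma hessian_quadratic (f : EuclideanSpace ℝ (Fin n) → ℝ) (y v : EuclideanSpace ℝ (Fin n)) :
    v.ofLp ⬝ᵥ hessian f y *ᵥ v.ofLp = inner ℝ (fderiv ℝ (gradient f) y v) v := by
  rw [hessian_mulVec, ← inner_eq_dotProduct, real_inner_comm]

/-- Every matrix is bounded with respect to the Euclidean norm. -/
lemma exists_bound_mulVec (A : Matrix (Fin n) (Fin n) ℝ) :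
    ∃ K : ℝ, 0 < K ∧ ∀ v : Fin n → ℝ, v ⬝ᵥ A *ᵥ v ≤ K * (v ⬝ᵥ v) ∧
      (A *ᵥ v) ⬝ᵥ (A *ᵥ v) ≤ K ^ 2 * (v ⬝ᵥ v) := by
  set T := Matrix.toEuclideanCLM (n := Fin n) (𝕜 := ℝ) A with hT
  refine ⟨‖T‖ + 1, by positivity, fun v => ?_⟩
  set y : EuclideanSpace ℝ (Fin n) := WithLp.toLp 2 v with hy
  have hv : v = y.ofLp := rfl
  have hAv : A *ᵥ v = (T y).ofLp := (Matrix.ofLp_toEuclideanCLM A y).symm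
  rw [hAv, hv, ← norm_sq_eq_dotProduct, ← norm_sq_eq_dotProduct, ← inner_eq_dotProduct]
  have h1 : ‖T y‖ ≤ (‖T‖ + 1) * ‖y‖ :=
    (T.le_opNorm y).trans (mul_le_mul_of_nonneg_right (by linarith) (norm_nonneg _))
  refine ⟨(real_inner_le_norm _ _).trans ?_, ?_⟩
  · nlinarith [norm_nonneg y]
  · rw [← mul_pow]
    exact pow_le_pow_left₀ (norm_nonneg _) h1 2

/-- `‖u‖² / K ≤ uᵀ W⁻¹ u` whenever `W ≤ K I`. -/
lemma dotProduct_self_le_inv {W : Matrix (Fin n) (Fin n) ℝ} (hW : W.PosDef) {K : ℝ}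
    (hK : ∀ v : Fin n → ℝ, v ⬝ᵥ W *ᵥ v ≤ K * (v ⬝ᵥ v)) (u : Fin n → ℝ) :
    u ⬝ᵥ u ≤ K * (u ⬝ᵥ W⁻¹ *ᵥ u) := by
  by_cases hu : u = 0
  · simp [hu]
  have h1 := sq_dotProduct_le_inv hW u u
  have h2 : 0 < u ⬝ᵥ u := by simpa using (dotProduct_star_self_pos_iff (v := u)).2 hu
  have h3 := (posDef_iff_real.1 hW.inv).2 u hu
  have h4 : (u ⬝ᵥ u) ^ 2 ≤ (K * (u ⬝ᵥ W⁻¹ *ᵥ u)) * (u ⬝ᵥ u) := by nlinarith [hK u]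
  rw [pow_two] at h4
  exact le_of_mul_le_mul_right h4 h2

/-- `uᵀ W⁻¹ u ≤ ‖u‖² / m` whenever `m I ≤ W`. -/
lemma inv_quadratic_le {W : Matrix (Fin n) (Fin n) ℝ} (hW : W.PosDef) {m : ℝ} (hm : 0 < m)
    (hmW : ∀ v : Fin n → ℝ, m * (v ⬝ᵥ v) ≤ v ⬝ᵥ W *ᵥ v) (u : Fin n → ℝ) :
    u ⬝ᵥ W⁻¹ *ᵥ u ≤ (u ⬝ᵥ u) / m := by
  have hdet : IsUnit W.det := hW.det_pos.ne'.isUnit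
  have h1 := hmW (W⁻¹ *ᵥ u)
  rw [mulVec_mulVec, mul_nonsing_inv _ hdet, one_mulVec, dotProduct_comm _ u] at h1
  have h2 := sq_dotProduct_mulVec_le (A := (1 : Matrix (Fin n) (Fin n) ℝ)) (by simp)
    (fun x => by simpa using dotProduct_star_self_nonneg x) u (W⁻¹ *ᵥ u)
  simp only [one_mulVec] at h2
  set a := u ⬝ᵥ W⁻¹ *ᵥ u
  have h3 : 0 ≤ u ⬝ᵥ u := by simpa using dotProduct_star_self_nonneg u
  rw [le_div_iff₀ hm]
  by_cases ha : a ≤ 0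
  · nlinarith
  push Not at ha
  have h4 : a * (a * m) ≤ a * (u ⬝ᵥ u) := by nlinarith
  exact le_of_mul_le_mul_left h4 ha

/-- For a fixed positive definite matrix the gain is a bounded function of the direction. -/
lemma exists_gain_le {B : Matrix (Fin n) (Fin n) ℝ} (hB : B.PosDef) :
    ∃ Γ : ℝ, ∀ v : Fin n → ℝ, v ≠ 0 → gain 1 B v ≤ Γ := by
  obtain ⟨K, hK, hKB⟩ := exists_bound_mulVec B
  obtain ⟨K', hK', hKB'⟩ := exists_bound_mulVec B⁻¹
  refine ⟨K ^ 2 * K' - 1 + Real.log K', fun v hv => ?_⟩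
  have hN : 0 < v ⬝ᵥ v := by simpa using (dotProduct_star_self_pos_iff (v := v)).2 hv
  have ha := (posDef_iff_real.1 hB).2 v hv
  have h1 : v ⬝ᵥ v ≤ K' * (v ⬝ᵥ B *ᵥ v) := by
    have := dotProduct_self_le_inv hB.inv (fun v => (hKB' v).1) v
    rwa [nonsing_inv_nonsing_inv _ hB.det_pos.ne'.isUnit] at this
  have h2 := (hKB v).2
  rw [gain, inv_one, one_mulVec, one_mulVec]
  have h3 : ((B *ᵥ v) ⬝ᵥ (B *ᵥ v)) / (v ⬝ᵥ B *ᵥ v) ≤ K ^ 2 * K' := by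
    rw [div_le_iff₀ ha]
    nlinarith [sq_nonneg K]
  have h4 : -Real.log ((v ⬝ᵥ B *ᵥ v) / (v ⬝ᵥ v)) ≤ Real.log K' := by
    rw [← Real.log_inv, inv_div]
    refine Real.log_le_log (by positivity) ?_
    rwa [div_le_iff₀ ha]
  linarith

/-- The gain of a positive semidefinite matrix with upper bound `M` in a direction of
curvature at least `c`. -/
lemma gain_one_le {G : Matrix (Fin n) (Fin n) ℝ} {M c : ℝ} (hG : Gᵀ = G)
    (h0 : ∀ v : Fin n → ℝ, 0 ≤ v ⬝ᵥ G *ᵥ v) (hM : ∀ v : Fin n → ℝ, v ⬝ᵥ G *ᵥ v ≤ M * (v ⬝ᵥ v))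
    (hc : 0 < c) {v : Fin n → ℝ} (hv : v ≠ 0) (hcv : c * (v ⬝ᵥ v) ≤ v ⬝ᵥ G *ᵥ v) :
    0 < v ⬝ᵥ G *ᵥ v ∧ gain 1 G v ≤ M - 1 - Real.log c := by
  have hN : 0 < v ⬝ᵥ v := by simpa using (dotProduct_star_self_pos_iff (v := v)).2 hv
  have ha : 0 < v ⬝ᵥ G *ᵥ v := lt_of_lt_of_le (by positivity) hcv
  refine ⟨ha, ?_⟩
  rw [gain, inv_one, one_mulVec, one_mulVec]
  have h1 : (G *ᵥ v) ⬝ᵥ (G *ᵥ v) ≤ M * (v ⬝ᵥ G *ᵥ v) := by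
    have h2 := sq_dotProduct_mulVec_le hG h0 (G *ᵥ v) v
    have h3 := hM (G *ᵥ v)
    by_cases hGv : G *ᵥ v = 0
    · simp [hGv]
    have h4 : 0 < (G *ᵥ v) ⬝ᵥ (G *ᵥ v) := by
      simpa using (dotProduct_star_self_pos_iff (v := G *ᵥ v)).2 hGv
    refine le_of_mul_le_mul_left (?_ : _ ≤ ((G *ᵥ v) ⬝ᵥ (G *ᵥ v)) * _) h4
    nlinarith
  have h5 : ((G *ᵥ v) ⬝ᵥ (G *ᵥ v)) / (v ⬝ᵥ G *ᵥ v) ≤ M := by rwa [div_le_iff₀ ha]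
  have h6 : Real.log c ≤ Real.log ((v ⬝ᵥ G *ᵥ v) / (v ⬝ᵥ v)) :=
    Real.log_le_log hc (by rwa [le_div_iff₀ hN])
  linarith

end Translation

/-! ### The Block BFGS update of filtered steps -/

section BlockStep

variable {n : ℕ} {ι : Type*}

lemma colMatrix_eq_columns (s : ι → EuclideanSpace ℝ (Fin n)) (J : List ι) :
    colMatrix s J = columns fun c => s (J.get c) := rfl

lemma length_le_of_mulVec_ne_zero {s : ι → EuclideanSpace ℝ (Fin n)} {J : List ι}
    (h : ∀ z : Fin J.length → ℝ, z ≠ 0 → colMatrix s J *ᵥ z ≠ 0) : J.length ≤ n := by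
  have hinj : Function.Injective (colMatrix s J).mulVecLin := by
    rw [injective_iff_map_eq_zero]
    intro z hz
    by_contra hz0
    exact h z hz0 hz
  simpa using LinearMap.finrank_le_finrank_of_injective hinj

/-- The form of `blockUpdate_potential` for the matrix of the steps listed in `J`. -/
lemma update_potential {W B G : Matrix (Fin n) (Fin n) ℝ} (hW : W.PosDef) (hG : Gᵀ = G)
    (hB : B.PosDef) {s : ι → EuclideanSpace ℝ (Fin n)} {J : List ι} {E : ℝ} (hE : 0 ≤ E)
    (h : ∀ z : Fin J.length → ℝ, z ≠ 0 →
      0 < (colMatrix s J *ᵥ z) ⬝ᵥ G *ᵥ (colMatrix s J *ᵥ z) ∧ gain W G (colMatrix s J *ᵥ z) ≤ E) :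
    (update B G (colMatrix s J)).PosDef ∧ ∀ i ∈ J, ∀ t : ℝ, t ≠ 0 →
      potential W (update B G (colMatrix s J))
        ≤ potential W B + n * E - gain W B (t • s i).ofLp := by
  obtain ⟨h1, -, h3⟩ := blockUpdate_potential hW hG J.length B (colMatrix s J) hB h
  refine ⟨h1, fun i hi t ht => ?_⟩
  have hlen : J.length ≤ n := length_le_of_mulVec_ne_zero (s := s) fun z hz h0 => by
    have := (h z hz).1
    simp [h0] at this
  have hlen' : (J.length : ℝ) * E ≤ n * E :=
    mul_le_mul_of_nonneg_right (by exact_mod_cast hlen) hE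
  obtain ⟨c, rfl⟩ := List.get_of_mem hi
  have hz : (Pi.single c t : Fin J.length → ℝ) ≠ 0 := by simpa using ht
  have h4 := h3 _ hz
  have h5 : colMatrix s J *ᵥ Pi.single c t = (t • s (J.get c)).ofLp := by
    ext a
    simp [colMatrix, mul_comm]
  rw [h5] at h4
  rw [blockUpdate] at h4
  rw [update]
  simp only [shadow] at h4
  linarith

/-- The retained steps are linearly independent. -/
lemma colMatrix_filterSteps_mulVec_ne_zero {τ M : ℝ} (hτ : 0 < τ) (hM : 0 < M)
    {G : Matrix (Fin n) (Fin n) ℝ} {s : ι → EuclideanSpace ℝ (Fin n)} {J : List ι} (hG : Gᵀ = G)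
    (h0 : ∀ v : Fin n → ℝ, 0 ≤ v ⬝ᵥ G *ᵥ v)
    (hM' : ∀ v : Fin n → ℝ, v ⬝ᵥ G *ᵥ v ≤ M * (v ⬝ᵥ v)) (hs : ∀ i, s i ≠ 0)
    {z : Fin (filterSteps G τ s J).length → ℝ} (hz : z ≠ 0) :
    colMatrix s (filterSteps G τ s J) *ᵥ z ≠ 0 := by
  obtain ⟨c, -, h⟩ := exists_coercive_of_pivotsPass (n := n) hτ hM (filterSteps G τ s J).length
  refine fun h1 => hz ((h G _ hG (fun v => h0 v.ofLp)
    (fun v => by rw [norm_sq_eq_dotProduct]; exact hM' v.ofLp) (fun j => hs _)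
    (pivotsPass_filterSteps G τ s J) z).2 ?_)
  rw [colMatrix_eq_columns, columns_mulVec] at h1
  exact WithLp.ofLp_injective 2 h1

/-- The filtering procedure keeps the growth of the potential bounded, wherever the Hessian is
positive semidefinite and at most `M`. -/
lemma exists_filtered_update_bound {τ M : ℝ} (hτ : 0 < τ) (hM : 0 < M) :
    ∃ C : ℝ, ∀ (B G : Matrix (Fin n) (Fin n) ℝ) (s : ι → EuclideanSpace ℝ (Fin n))
      (J : List ι), B.PosDef → Gᵀ = G → (∀ v : Fin n → ℝ, 0 ≤ v ⬝ᵥ G *ᵥ v) →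
      (∀ v : Fin n → ℝ, v ⬝ᵥ G *ᵥ v ≤ M * (v ⬝ᵥ v)) → (∀ i, s i ≠ 0) →
      (update B G (colMatrix s (filterSteps G τ s J))).PosDef ∧
      ∀ i ∈ filterSteps G τ s J, ∀ t : ℝ, t ≠ 0 →
        potential 1 (update B G (colMatrix s (filterSteps G τ s J)))
          ≤ potential 1 B + C - gain 1 B (t • s i).ofLp := by
  choose c hc hcoer using fun p => exists_coercive_of_pivotsPass (n := n) hτ hM p
  -- the number of retained columns is at most `n`, being linearly independent
  set E : ℝ := ∑ p ∈ Finset.range (n + 1), |M - 1 - Real.log (c p)| with hE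
  refine ⟨n * E, fun B G s J hB hG h0 hM' hs => ?_⟩
  set J' := filterSteps G τ s J with hJ'
  have hco := hcoer J'.length G (fun c => s (J'.get c)) hG (fun v => h0 v.ofLp)
    (fun v => by rw [norm_sq_eq_dotProduct]; exact hM' v.ofLp) (fun j => hs _)
    (pivotsPass_filterSteps G τ s J)
  have hne : ∀ z, z ≠ 0 → colMatrix s J' *ᵥ z ≠ 0 := fun z hz =>
    colMatrix_filterSteps_mulVec_ne_zero hτ hM hG h0 hM' hs hz
  have hlen : J'.length ≤ n := length_le_of_mulVec_ne_zero hne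
  refine update_potential PosDef.one hG hB (Finset.sum_nonneg fun _ _ => abs_nonneg _)
    fun z hz => ?_
  have hv := hne z hz
  have hcv := (hco z).1
  rw [norm_sq_eq_dotProduct, ← columns_mulVec, ← colMatrix_eq_columns] at hcv
  obtain ⟨h1, h2⟩ := gain_one_le hG h0 hM' (hc _) hv hcv
  refine ⟨h1, h2.trans ((le_abs_self _).trans ?_)⟩
  exact Finset.single_le_sum (f := fun p => |M - 1 - Real.log (c p)|)
    (fun _ _ => abs_nonneg _) (Finset.mem_range.2 (by omega))

end BlockStep

/-! ### Decrease in an Armijo-Wolfe step -/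

section Descent

variable {n : ℕ} {f : EuclideanSpace ℝ (Fin n) → ℝ}

/-- Decrease of `f` in an Armijo-Wolfe step, in terms of the angle between the direction and the
negative gradient. -/
lemma LineSearch.decrease {α β M : ℝ} (hα : 0 < α) (hM : 0 < M)
    (hc : ConvexOn ℝ Set.univ f) (h2 : Differentiable ℝ (gradient f))
    {x₁ y d : EuclideanSpace ℝ (Fin n)}
    (hH : ∀ y, f y ≤ f x₁ → ∀ v, inner ℝ (fderiv ℝ (gradient f) y v) v ≤ M * ‖v‖ ^ 2)
    (hy : f y ≤ f x₁) (hd : inner ℝ (gradient f y) d < 0) {lam : ℝ}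
    (hl : LineSearch f α β y d lam) :
    f (y + lam • d)
      ≤ f y - α * (1 - β) / M * ((inner ℝ (gradient f y) d) ^ 2 / ‖d‖ ^ 2) := by
  obtain ⟨hlam, ⟨harm, hwolfe⟩, -⟩ := hl
  set γ := inner ℝ (gradient f y) d with hγ
  have hd0 : d ≠ 0 := by rintro rfl; simp [hγ] at hd
  have hdn : 0 < ‖d‖ ^ 2 := by positivity
  have hle : f (y + lam • d) ≤ f x₁ := by
    have : α * lam * γ ≤ 0 := mul_nonpos_of_nonneg_of_nonpos (by positivity) hd.le
    linarith
  obtain ⟨ξ, hξ, hmv⟩ := exists_inner_gradient_sub h2 y (y + lam • d)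
  have hξ' : f ξ ≤ f x₁ :=
    ((hc.convex_le (f x₁)).segment_subset ⟨Set.mem_univ _, hy⟩ ⟨Set.mem_univ _, hle⟩ hξ).2
  rw [add_sub_cancel_left, inner_smul_right, inner_sub_left, ← hγ] at hmv
  have h3 := hH ξ hξ' (lam • d)
  rw [← hmv, norm_smul, mul_pow, Real.norm_eq_abs, sq_abs] at h3
  have h4 : inner ℝ (gradient f (y + lam • d)) d - γ ≤ lam * (M * ‖d‖ ^ 2) := by
    refine le_of_mul_le_mul_left ?_ hlam
    linarith
  have h5 : (1 - β) * (-γ) / (M * ‖d‖ ^ 2) ≤ lam := by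
    rw [div_le_iff₀ (by positivity)]
    linarith
  have h6 : α * lam * γ ≤ α * ((1 - β) * (-γ) / (M * ‖d‖ ^ 2)) * γ := by
    refine mul_le_mul_of_nonpos_right (mul_le_mul_of_nonneg_left h5 hα.le) hd.le
  have h7 : α * ((1 - β) * (-γ) / (M * ‖d‖ ^ 2)) * γ
      = -(α * (1 - β) / M * (γ ^ 2 / ‖d‖ ^ 2)) := by field_simp
  linarith

end Descent

/-! ### The Hessian of the objective -/

section ObjectiveFacts

variable {n : ℕ} {f : EuclideanSpace ℝ (Fin n) → ℝ} {x₁ xs : EuclideanSpace ℝ (Fin n)} {M : ℝ}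
  {μ : ℝ≥0}

lemma Objective.gradient_eq_zero (hf : Objective f x₁ xs M μ) : gradient f xs = 0 := by
  have h : IsLocalMin f xs := Filter.Eventually.of_forall hf.isMin
  rw [gradient, h.fderiv_eq_zero, map_zero]

lemma Objective.hessian_symm (hf : Objective f x₁ xs M μ) (y : EuclideanSpace ℝ (Fin n)) :
    (hessian f y)ᵀ = hessian f y := by
  have key : ∀ v w : EuclideanSpace ℝ (Fin n),
      v.ofLp ⬝ᵥ hessian f y *ᵥ w.ofLp = w.ofLp ⬝ᵥ hessian f y *ᵥ v.ofLp := fun v w => by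
    rw [hessian_mulVec, hessian_mulVec, ← inner_eq_dotProduct, ← inner_eq_dotProduct,
      real_inner_comm, inner_fderiv_gradient_comm hf.differentiable hf.twice_differentiable,
      real_inner_comm]
  ext i j
  have := key (EuclideanSpace.single j 1) (EuclideanSpace.single i 1)
  simpa using this

lemma Objective.hessian_nonneg (hf : Objective f x₁ xs M μ) (y : EuclideanSpace ℝ (Fin n))
    (v : Fin n → ℝ) : 0 ≤ v ⬝ᵥ hessian f y *ᵥ v := by
  have := inner_fderiv_gradient_nonneg hf.convex hf.differentiable hf.twice_differentiable y
    (WithLp.toLp 2 v)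
  rwa [← hessian_quadratic] at this

lemma Objective.hessian_quadratic_le (hf : Objective f x₁ xs M μ) {y : EuclideanSpace ℝ (Fin n)}
    (hy : f y ≤ f x₁) (v : Fin n → ℝ) :
    v ⬝ᵥ hessian f y *ᵥ v ≤ max M 1 * (v ⬝ᵥ v) := by
  have h := (posSemidef_real (hf.hessian_le y hy)).2 v
  rw [sub_mulVec, dotProduct_sub, smul_mulVec, one_mulVec, dotProduct_smul, smul_eq_mul] at h
  have h0 : 0 ≤ v ⬝ᵥ v := by simpa using dotProduct_star_self_nonneg v
  have := mul_le_mul_of_nonneg_right (le_max_left M 1) h0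
  linarith

end ObjectiveFacts

/-! ### Global convergence and the linear rate -/

section Run

variable {n q : ℕ} {f : EuclideanSpace ℝ (Fin n) → ℝ} {α β τ M : ℝ} {μ : ℝ≥0}
  {xs : EuclideanSpace ℝ (Fin n)} {x : ℕ → Fin (q + 1) → EuclideanSpace ℝ (Fin n)}
  {B : ℕ → Matrix (Fin n) (Fin n) ℝ} {lam : ℕ → Fin q → ℝ} {cand : ℕ → List (Fin q)}

lemma direction_eq_zero {k : ℕ} {i : Fin q} (h : gradient f (x k i.castSucc) = 0) :
    direction f x B k i = 0 := by rw [direction, h, map_zero, neg_zero]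

lemma stepAdmissible_of_gradient_eq_zero {k : ℕ} {i : Fin q}
    (h : gradient f (x k i.castSucc) = 0) :
    StepAdmissible f α β (x k i.castSucc) (direction f x B k i) 1 := by
  simp [StepAdmissible, direction_eq_zero h]

/-- Once the gradient vanishes, the iteration stops moving. -/
lemma IsRun.gradient_eq_zero_of_lt (hrun : IsRun f τ x B lam cand α β) {k₀ : ℕ} {i₀ : Fin q}
    (h : gradient f (x k₀ i₀.castSucc) = 0) :
    ∀ k, k₀ < k → ∀ j, gradient f (x k j) = 0 := by
  have hstay : ∀ k (i : Fin q), gradient f (x k i.castSucc) = 0 → gradient f (x k i.succ) = 0 := by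
    intro k i hi
    rw [hrun.iterate, step, direction_eq_zero hi, smul_zero, add_zero, hi]
  have hfirst : gradient f (x (k₀ + 1) 0) = 0 := by
    rw [hrun.next_block]
    have : ∀ j : Fin (q + 1), i₀.castSucc ≤ j → gradient f (x k₀ j) = 0 := by
      intro j
      induction j using Fin.induction with
      | zero =>
        intro hj
        rwa [← Fin.le_zero_iff.1 hj]
      | succ i ih =>
        intro hj
        rcases hj.eq_or_lt with hj | hj
        · rw [← hj]; exact h
        · exact hstay k₀ i (ih (Fin.le_castSucc_iff.2 hj))
    exact this _ (Fin.le_last _)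
  have hblock : ∀ k, gradient f (x k 0) = 0 → ∀ j, gradient f (x k j) = 0 := by
    intro k hk j
    induction j using Fin.induction with
    | zero => exact hk
    | succ i ih => exact hstay k i ih
  intro k hk
  induction k, Nat.succ_le_of_lt hk using Nat.le_induction with
  | base => exact hblock _ hfirst
  | succ k hk' ih =>
    refine hblock _ ?_
    rw [hrun.next_block]
    exact ih (Nat.lt_of_succ_le hk') _

lemma mulVec_direction {k : ℕ} (hB : (B k).PosDef) (i : Fin q) :
    B k *ᵥ (direction f x B k i).ofLp = -(gradient f (x k i.castSucc)).ofLp := by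
  rw [direction, WithLp.ofLp_neg, Matrix.ofLp_toEuclideanCLM, mulVec_neg, mulVec_mulVec,
    mul_nonsing_inv _ hB.det_pos.ne'.isUnit, one_mulVec]

lemma direction_ne_zero {k : ℕ} (hB : (B k).PosDef) {i : Fin q}
    (hg : gradient f (x k i.castSucc) ≠ 0) : (direction f x B k i).ofLp ≠ 0 := by
  intro h
  have h1 := mulVec_direction (f := f) (x := x) hB i
  rw [h, mulVec_zero, eq_comm, neg_eq_zero] at h1
  exact hg (WithLp.ofLp_injective 2 h1)

lemma inner_gradient_direction {k : ℕ} (hB : (B k).PosDef) (i : Fin q) :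
    inner ℝ (gradient f (x k i.castSucc)) (direction f x B k i)
      = -((direction f x B k i).ofLp ⬝ᵥ B k *ᵥ (direction f x B k i).ofLp) := by
  rw [mulVec_direction hB, inner_eq_dotProduct, dotProduct_neg, neg_neg, dotProduct_comm]

/-- The angle between the direction and the negative gradient is controlled by the gain. -/
lemma exp_neg_gain_mul_le {k : ℕ} (hB : (B k).PosDef) {i : Fin q}
    (hg : gradient f (x k i.castSucc) ≠ 0) :
    Real.exp (-gain 1 (B k) (direction f x B k i).ofLp) * ‖gradient f (x k i.castSucc)‖ ^ 2
      ≤ (inner ℝ (gradient f (x k i.castSucc)) (direction f x B k i)) ^ 2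
        / ‖direction f x B k i‖ ^ 2 := by
  have hd := direction_ne_zero hB hg
  have hgap := neg_log_le_gain PosDef.one hB hd
  have hquad := (posDef_iff_real.1 hB).2 _ hd
  rw [inner_gradient_direction hB, neg_sq]
  rw [inv_one, one_mulVec, one_mulVec] at hgap
  have hBd : (B k *ᵥ (direction f x B k i).ofLp) ⬝ᵥ (B k *ᵥ (direction f x B k i).ofLp)
      = ‖gradient f (x k i.castSucc)‖ ^ 2 := by
    rw [mulVec_direction hB, neg_dotProduct_neg, norm_sq_eq_dotProduct]
  rw [hBd, ← norm_sq_eq_dotProduct] at hgap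
  have hd' : 0 < ‖direction f x B k i‖ :=
    norm_pos_iff.2 fun h => hd (by rw [h]; rfl)
  have hg' : 0 < ‖gradient f (x k i.castSucc)‖ := norm_pos_iff.2 hg
  set a := (direction f x B k i).ofLp ⬝ᵥ B k *ᵥ (direction f x B k i).ofLp
  have h1 : Real.exp (-gain 1 (B k) (direction f x B k i).ofLp)
      ≤ a ^ 2 / (‖gradient f (x k i.castSucc)‖ ^ 2 * ‖direction f x B k i‖ ^ 2) := by
    rw [← Real.le_log_iff_exp_le (by positivity)]
    linarith
  calc _ ≤ a ^ 2 / (‖gradient f (x k i.castSucc)‖ ^ 2 * ‖direction f x B k i‖ ^ 2)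
        * ‖gradient f (x k i.castSucc)‖ ^ 2 := mul_le_mul_of_nonneg_right h1 (sq_nonneg _)
    _ = _ := by field_simp

/-- The properties of a run which never hits the minimizer: all matrices are positive definite,
every step decreases `f` in proportion to `exp (-gain)`, and the gain of every retained step is
lost from the potential, which otherwise grows by a bounded amount in each block. -/
structure Progress (f : EuclideanSpace ℝ (Fin n) → ℝ) (τ : ℝ)
    (x : ℕ → Fin (q + 1) → EuclideanSpace ℝ (Fin n)) (B : ℕ → Matrix (Fin n) (Fin n) ℝ)
    (lam : ℕ → Fin q → ℝ) (cand : ℕ → List (Fin q)) (c C : ℝ) : Prop where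
  gradient_ne_zero : ∀ k (i : Fin q), gradient f (x k i.castSucc) ≠ 0
  posDef : ∀ k, (B k).PosDef
  level : ∀ k j, f (x k j) ≤ f (x 0 0)
  next_block : ∀ k, x (k + 1) 0 = x k (Fin.last q)
  c_pos : 0 < c
  decrease : ∀ k (i : Fin q), f (x k i.succ) ≤ f (x k i.castSucc)
    - c * (Real.exp (-gain 1 (B k) (direction f x B k i).ofLp) *
      ‖gradient f (x k i.castSucc)‖ ^ 2)
  no_update : ∀ k, selected f τ x B lam cand k = [] → B (k + 1) = B k
  potential_le : ∀ k, ∀ i ∈ selected f τ x B lam cand k, potential 1 (B (k + 1))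
    ≤ potential 1 (B k) + C - gain 1 (B k) (direction f x B k i).ofLp

lemma IsRun.exists_progress (hrun : IsRun f τ x B lam cand α β) (hf : Objective f (x 0 0) xs M μ)
    (hα : 0 < α) (hβ : β < 1) (hτ : 0 < τ)
    (hg : ∀ k (i : Fin q), gradient f (x k i.castSucc) ≠ 0) :
    ∃ c C, Progress f τ x B lam cand c C := by
  have hM : (0 : ℝ) < max M 1 := lt_max_of_lt_right one_pos
  obtain ⟨C, hC⟩ := exists_filtered_update_bound (n := n) (ι := Fin q) hτ hM
  set c := α * (1 - β) / max M 1 with hc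
  have hcpos : 0 < c := div_pos (mul_pos hα (by linarith)) hM
  have hdec : ∀ k (i : Fin q), (B k).PosDef → f (x k i.castSucc) ≤ f (x 0 0) →
      f (x k i.succ) ≤ f (x k i.castSucc)
        - c * (Real.exp (-gain 1 (B k) (direction f x B k i).ofLp) *
          ‖gradient f (x k i.castSucc)‖ ^ 2) := by
    intro k i hB hlev
    have hneg : inner ℝ (gradient f (x k i.castSucc)) (direction f x B k i) < 0 := by
      rw [inner_gradient_direction hB, neg_lt_zero]
      exact (posDef_iff_real.1 hB).2 _ (direction_ne_zero hB (hg k i))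
    have h1 := (hrun.lineSearch k i).decrease hα hM hf.convex hf.twice_differentiable
      (fun y hy v => by
        rw [← hessian_quadratic, norm_sq_eq_dotProduct]
        exact hf.hessian_quadratic_le hy _) hlev hneg
    rw [hrun.iterate, step]
    have h2 := mul_le_mul_of_nonneg_left (exp_neg_gain_mul_le hB (hg k i)) hcpos.le
    linarith
  have hblock : ∀ k, (B k).PosDef → f (x k 0) ≤ f (x 0 0) → ∀ j, f (x k j) ≤ f (x 0 0) := by
    intro k hB h0 j
    induction j using Fin.induction with
    | zero => exact h0
    | succ i ih =>
      refine (hdec k i hB ih).trans ((sub_le_self _ ?_).trans ih)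
      positivity
  have hupd : ∀ k, (B k).PosDef → f (x k 0) ≤ f (x 0 0) →
      (B (k + 1)).PosDef ∧ ∀ i ∈ selected f τ x B lam cand k, potential 1 (B (k + 1))
        ≤ potential 1 (B k) + C - gain 1 (B k) (direction f x B k i).ofLp := by
    intro k hB h0
    by_cases hs : selected f τ x B lam cand k = []
    · rw [hrun.no_update k hs]
      exact ⟨hB, fun i hi => by simp [hs] at hi⟩
    · have hd : ∀ i, direction f x B k i ≠ 0 := fun i h =>
        direction_ne_zero hB (hg k i) (by rw [h]; rfl)
      have hl : ∀ i, lam k i ≠ 0 := fun i => (hrun.lineSearch k i).1.ne'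
      obtain ⟨h1, h2⟩ := hC (B k) (blockHessian f x k) (step f x B lam k) (cand k) hB
        (hf.hessian_symm _) (hf.hessian_nonneg _)
        (hf.hessian_quadratic_le (hblock k hB h0 _)) fun i => smul_ne_zero (hl i) (hd i)
      rw [hrun.update_eq k hs]
      refine ⟨h1, fun i hi => ?_⟩
      have := h2 i hi (lam k i)⁻¹ (inv_ne_zero (hl i))
      rwa [step, smul_smul, inv_mul_cancel₀ (hl i), one_smul] at this
  have hall : ∀ k, (B k).PosDef ∧ f (x k 0) ≤ f (x 0 0) := by
    intro k
    induction k with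
    | zero => exact ⟨hrun.posDef, le_rfl⟩
    | succ k ih =>
      refine ⟨(hupd k ih.1 ih.2).1, ?_⟩
      rw [hrun.next_block]
      exact hblock k ih.1 ih.2 _
  exact ⟨c, C, hg, fun k => (hall k).1, fun k => hblock k (hall k).1 (hall k).2, hrun.next_block,
    hcpos, fun k i => hdec k i (hall k).1 (hblock k (hall k).1 (hall k).2 _), hrun.no_update,
    fun k => (hupd k (hall k).1 (hall k).2).2⟩

variable {c C : ℝ}

lemma Progress.antitone_block (hp : Progress f τ x B lam cand c C) (k : ℕ) :
    Antitone fun j => f (x k j) := by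
  refine Fin.antitone_iff_succ_le.2 fun i => (hp.decrease k i).trans (sub_le_self _ ?_)
  have := hp.c_pos
  positivity

lemma Progress.antitone (hp : Progress f τ x B lam cand c C) : Antitone fun k => f (x k 0) :=
  antitone_nat_of_succ_le fun k => by
    rw [hp.next_block]
    exact hp.antitone_block k (Fin.zero_le _)

lemma Progress.block_le (hp : Progress f τ x B lam cand c C) (k : ℕ) (i : Fin q) :
    f (x (k + 1) 0) ≤ f (x k 0)
    - c * (Real.exp (-gain 1 (B k) (direction f x B k i).ofLp) *
      ‖gradient f (x k i.castSucc)‖ ^ 2) := by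
  have h1 := hp.decrease k i
  have h2 : f (x k i.castSucc) ≤ f (x k 0) := hp.antitone_block k (Fin.zero_le _)
  have h3 : f (x k (Fin.last q)) ≤ f (x k i.succ) := hp.antitone_block k (Fin.le_last _)
  rw [hp.next_block]
  linarith

/-- A sequence bounded below which increases by summable amounts only, has differences tending
to zero. -/
lemma tendsto_sub_succ_of_summable {a e : ℕ → ℝ} {l : ℝ} (hl : ∀ k, l ≤ a k) (he : Summable e)
    (hae : ∀ᶠ k in atTop, a (k + 1) ≤ a k + e k) :
    Tendsto (fun k => a k + e k - a (k + 1)) atTop (𝓝 0) := by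
  obtain ⟨K, hK⟩ := eventually_atTop.1 hae
  have hsum := he.hasSum.tendsto_sum_nat
  -- subtracting the partial sums makes the sequence eventually antitone
  set b : ℕ → ℝ := fun k => a k - ∑ j ∈ Finset.range k, e j with hb
  have hbb : ∀ k, b k - b (k + 1) = a k + e k - a (k + 1) := fun k => by
    simp only [hb, Finset.sum_range_succ]; ring
  have hanti : Antitone fun k => b (k + K) := antitone_nat_of_succ_le fun k => by
    have h1 := hbb (k + K)
    have h2 := hK (k + K) (by omega)
    rw [show k + 1 + K = k + K + 1 by omega]
    linarith
  obtain ⟨u, hu⟩ := hsum.bddAbove_range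
  have hbdd : BddBelow (Set.range fun k => b (k + K)) := by
    refine ⟨l - u, ?_⟩
    rintro _ ⟨k, rfl⟩
    have h1 := hl (k + K)
    have h2 : ∑ j ∈ Finset.range (k + K), e j ≤ u := hu ⟨k + K, rfl⟩
    simp only [hb]
    linarith
  have hlim := (tendsto_add_atTop_iff_nat K).1 (tendsto_atTop_ciInf hanti hbdd)
  have := hlim.sub ((tendsto_add_atTop_iff_nat 1).2 hlim)
  rw [sub_self] at this
  exact this.congr hbb

/-- The values of `f` approach the minimum. Otherwise the gradients stay away from zero, hence
all gains tend to infinity. Then every update decreases the potential by at least `1`, so that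
only finitely many updates take place; but with a fixed matrix the gains are bounded. -/
lemma Progress.exists_lt (hp : Progress f τ x B lam cand c C) (hq : 0 < q)
    (hc : ConvexOn ℝ Set.univ f) (hd : Differentiable ℝ f) (hmin : ∀ y, f xs ≤ f y) {R : ℝ}
    (hR : ∀ y, f y ≤ f (x 0 0) → ‖y - xs‖ ≤ R) {η : ℝ} (hη : 0 < η) :
    ∃ k, f (x k 0) < f xs + η := by
  by_contra! hge
  have hcpos := hp.c_pos
  set R' := max R 1 with hR'
  have hR'pos : 0 < R' := lt_max_of_lt_right one_pos
  have hgrad : ∀ k (i : Fin q), η / R' ≤ ‖gradient f (x k i.castSucc)‖ := by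
    intro k i
    rw [div_le_iff₀ hR'pos]
    have h1 := add_inner_gradient_le hc hd (x k i.castSucc) xs
    have h2 : η ≤ f (x k i.castSucc) - f xs := by
      have h3 := hge (k + 1)
      have h4 : f (x k (Fin.last q)) ≤ f (x k i.castSucc) := hp.antitone_block k (Fin.le_last _)
      rw [hp.next_block] at h3
      linarith
    have h3 := abs_le.1 (abs_real_inner_le_norm (gradient f (x k i.castSucc)) (xs - x k i.castSucc))
    have h4 : ‖xs - x k i.castSucc‖ ≤ R' := by
      rw [norm_sub_rev]
      exact (hR _ (hp.level k _)).trans (le_max_left _ _)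
    have h5 := mul_le_mul_of_nonneg_left h4 (norm_nonneg (gradient f (x k i.castSucc)))
    linarith [h3.1]
  -- all gains tend to infinity
  have hgain : ∀ Γ : ℝ, ∀ᶠ k in atTop, ∀ i : Fin q,
      Γ ≤ gain 1 (B k) (direction f x B k i).ofLp := by
    intro Γ
    have hbdd : ∀ k, f xs ≤ f (x k 0) := fun k => hmin _
    have ht := tendsto_sub_succ_of_summable hbdd (summable_zero)
      (Eventually.of_forall fun k => by simpa using hp.antitone (Nat.le_succ k))
    have hpos : 0 < c * (Real.exp (-Γ) * (η / R') ^ 2) := by positivity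
    filter_upwards [ht.eventually_lt_const hpos] with k hk i
    by_contra! hlt
    have h1 := hp.block_le k i
    have h2 : Real.exp (-Γ) ≤ Real.exp (-gain 1 (B k) (direction f x B k i).ofLp) :=
      Real.exp_le_exp.2 (by linarith)
    have h3 : (η / R') ^ 2 ≤ ‖gradient f (x k i.castSucc)‖ ^ 2 :=
      pow_le_pow_left₀ (by positivity) (hgrad k i) 2
    have h4 : c * (Real.exp (-Γ) * (η / R') ^ 2)
        ≤ c * (Real.exp (-gain 1 (B k) (direction f x B k i).ofLp) *
          ‖gradient f (x k i.castSucc)‖ ^ 2) := by gcongr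
    rw [add_zero] at hk
    linarith
  have hdrop : ∀ᶠ k in atTop, selected f τ x B lam cand k ≠ [] →
      potential 1 (B (k + 1)) ≤ potential 1 (B k) - 1 := by
    filter_upwards [hgain (C + 1)] with k hk hs
    obtain ⟨i, hi⟩ := List.exists_mem_of_ne_nil _ hs
    have := hp.potential_le k i hi
    linarith [hk i]
  have hfin : ∀ᶠ k in atTop, selected f τ x B lam cand k = [] := by
    obtain ⟨l, hl⟩ := exists_le_potential (W := (1 : Matrix (Fin n) (Fin n) ℝ)) PosDef.one
    have ht := tendsto_sub_succ_of_summable (a := fun k => potential 1 (B k))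
      (fun k => hl _ (hp.posDef k)) summable_zero (by
        filter_upwards [hdrop] with k hk
        by_cases hs : selected f τ x B lam cand k = []
        · rw [hp.no_update k hs, add_zero]
        · linarith [hk hs])
    filter_upwards [hdrop, ht.eventually_lt_const one_pos] with k hk hlt
    by_contra hs
    have := hk hs
    linarith
  obtain ⟨K, hK⟩ := eventually_atTop.1 hfin
  have hconst : ∀ k, K ≤ k → B k = B K := by
    intro k hk
    induction k, hk using Nat.le_induction with
    | base => rfl
    | succ k hk ih => rw [hp.no_update k (hK k hk), ih]
  obtain ⟨Γ, hΓ⟩ := exists_gain_le (hp.posDef K)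
  obtain ⟨k, hk, hkK⟩ := ((hgain (Γ + 1)).and (eventually_ge_atTop K)).exists
  have h1 := hk ⟨0, hq⟩
  have h2 := hΓ _ (direction_ne_zero (f := f) (x := x) (hp.posDef k) (hp.gradient_ne_zero k ⟨0, hq⟩))
  rw [hconst k hkK] at h1
  linarith

/-- Convergence of the iterates at a linear rate, in the form needed here: the distances to the
minimizer are summable. The function value times the exponential of a multiple of the potential
contracts by a fixed factor in each block. -/
lemma Progress.summable_norm (hp : Progress f τ x B lam cand c C) (hmin : ∀ y, f xs ≤ f y)
    {m : ℝ} (hm : 0 < m) {K : ℕ}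
    (hsel : ∀ k, K ≤ k → selected f τ x B lam cand k ≠ [])
    (hnear : ∀ k, K ≤ k → ∀ j, m * (f (x k j) - f xs) ≤ ‖gradient f (x k j)‖ ^ 2 ∧
      m / 4 * ‖x k j - xs‖ ^ 2 ≤ f (x k j) - f xs) :
    Summable fun k => ‖x k 0 - xs‖ := by
  have hcpos := hp.c_pos
  obtain ⟨l, hl⟩ := exists_le_potential (W := (1 : Matrix (Fin n) (Fin n) ℝ)) PosDef.one
  set c' := c * m * Real.exp (-C) with hc'
  have hc'pos : 0 < c' := by positivity
  set Θ : ℕ → ℝ := fun k => (f (x k 0) - f xs) * Real.exp (c' * potential 1 (B k)) with hΘ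
  have hstep : ∀ k, K ≤ k → Θ (k + 1) ≤ Real.exp (-c') * Θ k := by
    intro k hk
    obtain ⟨i, hi⟩ := List.exists_mem_of_ne_nil _ (hsel k hk)
    have hpot := hp.potential_le k i hi
    set g := gain 1 (B k) (direction f x B k i).ofLp with hg
    have h1 := (hnear k hk i.castSucc).1
    have h2 := hp.decrease k i
    rw [← hg] at h2
    have h3 : f (x k i.castSucc) ≤ f (x k 0) := hp.antitone_block k (Fin.zero_le _)
    have h4 : f (x k (Fin.last q)) ≤ f (x k i.succ) := hp.antitone_block k (Fin.le_last _)
    rw [← hp.next_block] at h4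
    have h5 : f (x (k + 1) 0) - f xs
        ≤ (1 - c * m * Real.exp (-g)) * (f (x k i.castSucc) - f xs) := by
      have : c * Real.exp (-g) * (m * (f (x k i.castSucc) - f xs))
          ≤ c * Real.exp (-g) * ‖gradient f (x k i.castSucc)‖ ^ 2 :=
        mul_le_mul_of_nonneg_left h1 (by positivity)
      linarith
    have h6 : f (x (k + 1) 0) - f xs
        ≤ Real.exp (-(c * m * Real.exp (-g))) * (f (x k 0) - f xs) := by
      have e1 : 1 - c * m * Real.exp (-g) ≤ Real.exp (-(c * m * Real.exp (-g))) := by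
        have := Real.add_one_le_exp (-(c * m * Real.exp (-g)))
        linarith
      refine h5.trans (mul_le_mul e1 (by linarith) ?_ (Real.exp_pos _).le)
      linarith [hmin (x k i.castSucc)]
    -- `exp (-g) ≥ exp (-C) (1 + C - g)`, and `C - g` bounds the increase of the potential
    have h7 : c' * (1 + (potential 1 (B (k + 1)) - potential 1 (B k)))
        ≤ c * m * Real.exp (-g) := by
      have e1 : Real.exp (-g) = Real.exp (-C) * Real.exp (C - g) := by
        rw [← Real.exp_add]; congr 1; ring
      have e2 := Real.add_one_le_exp (C - g)
      rw [e1, hc', mul_assoc (c * m)]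
      gcongr
      linarith
    have h8 : 0 ≤ f (x k 0) - f xs := by linarith [hmin (x k 0)]
    calc Θ (k + 1) ≤ Real.exp (-(c * m * Real.exp (-g))) * (f (x k 0) - f xs)
          * Real.exp (c' * potential 1 (B (k + 1))) :=
        mul_le_mul_of_nonneg_right h6 (Real.exp_pos _).le
      _ = (f (x k 0) - f xs)
          * Real.exp (-(c * m * Real.exp (-g)) + c' * potential 1 (B (k + 1))) := by
        rw [Real.exp_add]; ring
      _ ≤ (f (x k 0) - f xs) * Real.exp (-c' + c' * potential 1 (B k)) :=
        mul_le_mul_of_nonneg_left (Real.exp_le_exp.2 (by linarith)) h8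
      _ = Real.exp (-c') * Θ k := by rw [Real.exp_add, hΘ]; ring
  have hgeo : ∀ j, Θ (j + K) ≤ Real.exp (-c') ^ j * Θ K := by
    intro j
    induction j with
    | zero => simp
    | succ j ih =>
      have h1 := hstep (j + K) (by omega)
      rw [show j + 1 + K = j + K + 1 by omega, pow_succ, mul_comm _ (Real.exp (-c')), mul_assoc]
      exact h1.trans (mul_le_mul_of_nonneg_left ih (Real.exp_pos _).le)
  set ρ := Real.exp (-c' / 2) with hρ
  have hρ2 : Real.exp (-c') = ρ ^ 2 := by
    rw [hρ, ← Real.exp_nat_mul]; congr 1; push_cast; ring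
  have hρ1 : ρ < 1 := by rw [hρ, Real.exp_lt_one_iff]; linarith
  have hΘK : 0 ≤ Θ K := mul_nonneg (by linarith [hmin (x K 0)]) (Real.exp_pos _).le
  set A := 4 / m * Real.exp (-(c' * l)) * Θ K with hA
  have hA0 : 0 ≤ A := by positivity
  refine (summable_nat_add_iff K).1 (Summable.of_nonneg_of_le (fun _ => norm_nonneg _) (fun j => ?_)
    ((summable_geometric_of_lt_one (Real.exp_pos _).le hρ1).mul_left (Real.sqrt A)))
  have h1 := (hnear (j + K) (by omega) 0).2
  have h2 : f (x (j + K) 0) - f xs ≤ Real.exp (-(c' * l)) * Θ (j + K) := by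
    have e1 : 1 ≤ Real.exp (-(c' * l)) * Real.exp (c' * potential 1 (B (j + K))) := by
      rw [← Real.exp_add]
      refine Real.one_le_exp ?_
      have := mul_le_mul_of_nonneg_left (hl _ (hp.posDef (j + K))) hc'pos.le
      linarith
    have e2 : 0 ≤ f (x (j + K) 0) - f xs := by linarith [hmin (x (j + K) 0)]
    have := mul_le_mul_of_nonneg_left e1 e2
    rw [hΘ]
    linarith
  have h3 := mul_le_mul_of_nonneg_left (hgeo j) (Real.exp_pos (-(c' * l))).le
  have h4 : ‖x (j + K) 0 - xs‖ ^ 2 ≤ A * (ρ ^ j) ^ 2 := by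
    have e1 : ‖x (j + K) 0 - xs‖ ^ 2 ≤ 4 / m * (f (x (j + K) 0) - f xs) := by
      rw [div_mul_eq_mul_div, le_div_iff₀ hm]
      linarith
    have e2 : 4 / m * (f (x (j + K) 0) - f xs)
        ≤ 4 / m * (Real.exp (-(c' * l)) * (Real.exp (-c') ^ j * Θ K)) :=
      mul_le_mul_of_nonneg_left (h2.trans h3) (by positivity)
    refine e1.trans (e2.trans (le_of_eq ?_))
    rw [hA, hρ2]
    ring
  have h5 := Real.abs_le_sqrt h4
  rwa [abs_of_nonneg (norm_nonneg _), Real.sqrt_mul hA0,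
    Real.sqrt_sq (pow_nonneg (Real.exp_pos _).le j)] at h5

end Run

/-! ### The objective near its minimizer -/

section Minimizer

variable {n : ℕ} {f : EuclideanSpace ℝ (Fin n) → ℝ} {x₁ xs : EuclideanSpace ℝ (Fin n)}
  {m M : ℝ} {μ : ℝ≥0} {S : Set (EuclideanSpace ℝ (Fin n))}

lemma le_quadratic_of_posSemidef_sub {A : Matrix (Fin n) (Fin n) ℝ}
    (h : (A - m • (1 : Matrix (Fin n) (Fin n) ℝ)).PosSemidef) (v : Fin n → ℝ) :
    m * (v ⬝ᵥ v) ≤ v ⬝ᵥ A *ᵥ v := by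
  have h1 := (posSemidef_real h).2 v
  rw [sub_mulVec, dotProduct_sub, smul_mulVec, one_mulVec, dotProduct_smul, smul_eq_mul] at h1
  linarith

lemma posDef_of_le_quadratic {A : Matrix (Fin n) (Fin n) ℝ} (hA : Aᵀ = A) (hm : 0 < m)
    (h : ∀ v : Fin n → ℝ, m * (v ⬝ᵥ v) ≤ v ⬝ᵥ A *ᵥ v) : A.PosDef := by
  refine posDef_iff_real.2 ⟨hA, fun v hv => lt_of_lt_of_le (mul_pos hm ?_) (h v)⟩
  simpa using (dotProduct_star_self_pos_iff (v := v)).2 hv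

lemma Objective.exists_radius (hf : Objective f x₁ xs M μ) (hS : S ∈ 𝓝 xs)
    (hm : ∀ y ∈ S, (hessian f y - m • (1 : Matrix (Fin n) (Fin n) ℝ)).PosSemidef) :
    ∃ r > 0, ∀ y, ‖y - xs‖ ≤ r → (∀ v : Fin n → ℝ, m * (v ⬝ᵥ v) ≤ v ⬝ᵥ hessian f y *ᵥ v) ∧
      ‖fderiv ℝ (gradient f) y - fderiv ℝ (gradient f) xs‖ ≤ μ * ‖y - xs‖ := by
  obtain ⟨U, hU, hL⟩ := hf.hessian_lipschitz
  obtain ⟨r, hr, hrS⟩ := Metric.nhds_basis_closedBall.mem_iff.1 (Filter.inter_mem hS hU)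
  refine ⟨r, hr, fun y hy => ?_⟩
  have hyS := hrS (mem_closedBall_iff_norm.2 hy)
  refine ⟨le_quadratic_of_posSemidef_sub (hm y hyS.1), ?_⟩
  have := hL.dist_le_mul y hyS.2 xs (mem_of_mem_nhds hU)
  rwa [dist_eq_norm, dist_eq_norm] at this

lemma Objective.continuousAt_hessian (hf : Objective f x₁ xs M μ) :
    ContinuousAt (fderiv ℝ (gradient f)) xs := by
  obtain ⟨U, hU, hL⟩ := hf.hessian_lipschitz
  exact hL.continuousOn.continuousAt hU

lemma Objective.growth (hf : Objective f x₁ xs M μ) {r : ℝ}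
    (hr : ∀ y, ‖y - xs‖ ≤ r → ∀ v : Fin n → ℝ, m * (v ⬝ᵥ v) ≤ v ⬝ᵥ hessian f y *ᵥ v)
    {z : EuclideanSpace ℝ (Fin n)} (hz : ‖z - xs‖ ≤ r) :
    m * ‖z - xs‖ ^ 2 ≤ inner ℝ (gradient f z) (z - xs) ∧
      m / 4 * ‖z - xs‖ ^ 2 ≤ f z - f xs :=
  growth_of_le_hessian hf.convex hf.differentiable hf.twice_differentiable hf.isMin
    hf.gradient_eq_zero (fun y hy v => by
      rw [← hessian_quadratic, norm_sq_eq_dotProduct]; exact hr y hy _) hz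

/-- The Polyak-Łojasiewicz inequality near the minimizer. -/
lemma Objective.mul_sub_le_norm_gradient_sq (hf : Objective f x₁ xs M μ) (hm : 0 < m) {r : ℝ}
    (hr : ∀ y, ‖y - xs‖ ≤ r → ∀ v : Fin n → ℝ, m * (v ⬝ᵥ v) ≤ v ⬝ᵥ hessian f y *ᵥ v)
    {z : EuclideanSpace ℝ (Fin n)} (hz : ‖z - xs‖ ≤ r) :
    m * (f z - f xs) ≤ ‖gradient f z‖ ^ 2 := by
  have h1 := (hf.growth hr hz).1
  have h2 := add_inner_gradient_le hf.convex hf.differentiable z xs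
  rw [← neg_sub z xs, inner_neg_right] at h2
  have h3 := real_inner_le_norm (gradient f z) (z - xs)
  have h4 : m * ‖z - xs‖ ≤ ‖gradient f z‖ := by
    rcases (norm_nonneg (z - xs)).eq_or_lt with h | h
    · rw [← h, mul_zero]; exact norm_nonneg _
    · refine le_of_mul_le_mul_right ?_ h
      nlinarith
  have h5 : m * (f z - f xs) ≤ m * (‖gradient f z‖ * ‖z - xs‖) :=
    mul_le_mul_of_nonneg_left (by linarith) hm.le
  nlinarith [norm_nonneg (gradient f z)]

/-- A small value of `f` forces a point to be close to the minimizer. -/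
lemma Objective.norm_sub_lt (hf : Objective f x₁ xs M μ) (hm : 0 < m) {r : ℝ}
    (hr : ∀ y, ‖y - xs‖ ≤ r → ∀ v : Fin n → ℝ, m * (v ⬝ᵥ v) ≤ v ⬝ᵥ hessian f y *ᵥ v)
    {ε : ℝ} (hε : 0 < ε) (hεr : ε ≤ r) {y : EuclideanSpace ℝ (Fin n)}
    (hy : f y < f xs + m / 4 * ε ^ 2) : ‖y - xs‖ < ε := by
  by_contra! hge
  have h1 := growth_far hf.convex (c := m / 4) hε
    (fun z hz => (hf.growth hr (hz.trans hεr)).2) hge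
  have h2 := mul_le_mul_of_nonneg_left hge (by positivity : 0 ≤ m / 4 * ε)
  nlinarith

lemma Objective.exists_level_bound (hf : Objective f x₁ xs M μ) (hm : 0 < m) {r : ℝ} (hr0 : 0 < r)
    (hr : ∀ y, ‖y - xs‖ ≤ r → ∀ v : Fin n → ℝ, m * (v ⬝ᵥ v) ≤ v ⬝ᵥ hessian f y *ᵥ v) :
    ∃ R, ∀ y, f y ≤ f x₁ → ‖y - xs‖ ≤ R := by
  refine ⟨max r ((f x₁ - f xs) / (m / 4 * r)), fun y hy => ?_⟩
  rcases le_total ‖y - xs‖ r with h | h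
  · exact h.trans (le_max_left _ _)
  · refine le_trans ?_ (le_max_right _ _)
    rw [le_div_iff₀ (by positivity)]
    have := growth_far hf.convex (c := m / 4) hr0 (fun z hz => (hf.growth hr hz).2) h
    linarith

/-- Near the minimizer the gain of the Hessian, relative to the Hessian at the minimizer, is at
most proportional to the distance. -/
lemma Objective.gain_hessian_le (hf : Objective f x₁ xs M μ) (hm : 0 < m)
    (hW : ∀ v : Fin n → ℝ, m * (v ⬝ᵥ v) ≤ v ⬝ᵥ hessian f xs *ᵥ v)
    {y : EuclideanSpace ℝ (Fin n)}
    (hL : ‖fderiv ℝ (gradient f) y - fderiv ℝ (gradient f) xs‖ ≤ μ * ‖y - xs‖)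
    (hy : μ * ‖y - xs‖ / m ≤ 1 / 2) {v : Fin n → ℝ} (hv : v ≠ 0) :
    gain (hessian f xs) (hessian f y) v ≤ μ * ‖y - xs‖ / m := by
  have hWp := posDef_of_le_quadratic (hf.hessian_symm xs) hm hW
  set e := μ * ‖y - xs‖ with he
  have he0 : 0 ≤ e := by positivity
  set u : EuclideanSpace ℝ (Fin n) := WithLp.toLp 2 v with hu
  set w := fderiv ℝ (gradient f) y u - fderiv ℝ (gradient f) xs u with hw
  have hvu : v = u.ofLp := rfl
  have hwe : ‖w‖ ≤ e * ‖u‖ := by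
    have h1 := (fderiv ℝ (gradient f) y - fderiv ℝ (gradient f) xs).le_opNorm u
    exact h1.trans (mul_le_mul_of_nonneg_right hL (norm_nonneg _))
  have hdiff : hessian f y *ᵥ v - hessian f xs *ᵥ v = w.ofLp := by
    rw [hvu, hessian_mulVec, hessian_mulVec, hw]; rfl
  have hNu : ‖u‖ ^ 2 = v ⬝ᵥ v := norm_sq_eq_dotProduct u
  have hN : ‖u‖ ^ 2 ≤ (v ⬝ᵥ hessian f xs *ᵥ v) / m := by
    rw [hNu, le_div_iff₀ hm]; linarith [hW v]
  have h1 := gain_le_of_near hWp (G := hessian f y) hv hy ?_ ?_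
  · refine h1.trans ?_
    have : 0 ≤ e / m := by positivity
    nlinarith
  · rw [← dotProduct_sub, hdiff, hvu, ← inner_eq_dotProduct]
    refine (abs_real_inner_le_norm _ _).trans ?_
    calc ‖u‖ * ‖w‖ ≤ ‖u‖ * (e * ‖u‖) := mul_le_mul_of_nonneg_left hwe (norm_nonneg _)
      _ = e * ‖u‖ ^ 2 := by ring
      _ ≤ e * ((v ⬝ᵥ hessian f xs *ᵥ v) / m) := mul_le_mul_of_nonneg_left hN he0
      _ = _ := by ring
  · rw [hdiff]
    refine (inv_quadratic_le hWp hm hW _).trans ?_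
    rw [← norm_sq_eq_dotProduct, div_le_iff₀ hm]
    calc ‖w‖ ^ 2 ≤ (e * ‖u‖) ^ 2 := pow_le_pow_left₀ (norm_nonneg _) hwe 2
      _ = e ^ 2 * ‖u‖ ^ 2 := by ring
      _ ≤ e ^ 2 * ((v ⬝ᵥ hessian f xs *ᵥ v) / m) := mul_le_mul_of_nonneg_left hN (sq_nonneg _)
      _ = _ := by field_simp

end Minimizer

/-! ### The retained steps of late blocks -/

section Eventual

variable {n q : ℕ} {f : EuclideanSpace ℝ (Fin n) → ℝ} {α β τ m M : ℝ} {μ : ℝ≥0}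
  {xs : EuclideanSpace ℝ (Fin n)} {x : ℕ → Fin (q + 1) → EuclideanSpace ℝ (Fin n)}
  {B : ℕ → Matrix (Fin n) (Fin n) ℝ} {lam : ℕ → Fin q → ℝ} {cand : ℕ → List (Fin q)}
  {S : Set (EuclideanSpace ℝ (Fin n))}

/-- All iterates of the late blocks are close to the minimizer. -/
lemma Progress.eventually_near {c C : ℝ} (hp : Progress f τ x B lam cand c C)
    (hf : Objective f (x 0 0) xs M μ) (hq : 0 < q) (hm : 0 < m) {r : ℝ} (hr0 : 0 < r)
    (hr : ∀ y, ‖y - xs‖ ≤ r → ∀ v : Fin n → ℝ, m * (v ⬝ᵥ v) ≤ v ⬝ᵥ hessian f y *ᵥ v)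
    {ε : ℝ} (hε : 0 < ε) : ∀ᶠ k in atTop, ∀ j, ‖x k j - xs‖ < ε := by
  obtain ⟨R, hR⟩ := hf.exists_level_bound hm hr0 hr
  have hε' : 0 < min ε r := lt_min hε hr0
  obtain ⟨K, hK⟩ := hp.exists_lt hq hf.convex hf.differentiable hf.isMin hR
    (by positivity : 0 < m / 4 * min ε r ^ 2)
  filter_upwards [eventually_ge_atTop K] with k hk j
  have h1 : f (x k j) ≤ f (x k 0) := hp.antitone_block k (Fin.zero_le _)
  have h2 : f (x k 0) ≤ f (x K 0) := hp.antitone hk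
  exact (hf.norm_sub_lt hm hr hε' (min_le_right _ _) (by linarith)).trans_le (min_le_left _ _)

/-- The gains of the retained steps, relative to the Hessian at the minimizer, tend to zero: by
the potential with respect to this Hessian they are summable, as the distances of the iterates to
the minimizer are. -/
lemma Progress.eventually_gain_lt {c C : ℝ} (hp : Progress f τ x B lam cand c C)
    (hrun : IsRun f τ x B lam cand α β) (hf : Objective f (x 0 0) xs M μ) (hq : 0 < q)
    (hτ₀ : 0 < τ) (hτ : τ ≤ m) {r : ℝ} (hr0 : 0 < r)
    (hr : ∀ y, ‖y - xs‖ ≤ r → (∀ v : Fin n → ℝ, m * (v ⬝ᵥ v) ≤ v ⬝ᵥ hessian f y *ᵥ v) ∧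
      ‖fderiv ℝ (gradient f) y - fderiv ℝ (gradient f) xs‖ ≤ μ * ‖y - xs‖)
    {δ : ℝ} (hδ : 0 < δ) : ∀ᶠ k in atTop, ∀ i ∈ selected f τ x B lam cand k,
      gain (hessian f xs) (B k) (direction f x B k i).ofLp < δ := by
  have hm : 0 < m := hτ₀.trans_le hτ
  have hr1 := fun y hy => (hr y hy).1
  have hW := hr1 xs (by simpa using hr0.le)
  have hWp := posDef_of_le_quadratic (hf.hessian_symm xs) hm hW
  have hnear := hp.eventually_near hf hq hm hr0 hr1 hr0
  have hne : ∀ᶠ k in atTop, selected f τ x B lam cand k ≠ [] := by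
    filter_upwards [hnear] with k hk
    refine filterSteps_ne_nil (hrun.cand_ne_nil k) fun v => ?_
    rw [norm_sq_eq_dotProduct]
    refine le_trans ?_ (hr1 _ (hk (Fin.last q)).le v.ofLp)
    refine mul_le_mul_of_nonneg_right hτ ?_
    rw [← norm_sq_eq_dotProduct]
    positivity
  -- the distances are summable
  have hsum : Summable fun k => ‖x k 0 - xs‖ := by
    obtain ⟨K, hK⟩ := eventually_atTop.1 (hnear.and hne)
    exact hp.summable_norm hf.isMin hm (K := K) (fun k hk => (hK k hk).2) fun k hk j =>
      ⟨hf.mul_sub_le_norm_gradient_sq hm hr1 ((hK k hk).1 j).le,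
        (hf.growth hr1 ((hK k hk).1 j).le).2⟩
  set e : ℕ → ℝ := fun k => μ * ‖x k (Fin.last q) - xs‖ / m with he
  have hesum : Summable e := by
    have h1 := ((summable_nat_add_iff 1).2 hsum).mul_left ((μ : ℝ) / m)
    refine h1.congr fun k => ?_
    simp only [he]
    rw [hp.next_block]
    ring
  have he0 : ∀ k, 0 ≤ e k := fun k => by positivity
  have hpot : ∀ᶠ k in atTop, ∀ i ∈ selected f τ x B lam cand k,
      potential (hessian f xs) (B (k + 1)) ≤ potential (hessian f xs) (B k) + n * e k
        - gain (hessian f xs) (B k) (direction f x B k i).ofLp := by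
    filter_upwards [hnear, hne, hesum.tendsto_atTop_zero.eventually_le_const
      (by norm_num : (0 : ℝ) < 1 / 2)] with k hk hs he2 i hi
    obtain ⟨hG, hL⟩ := hr _ (hk (Fin.last q)).le
    have hGp := posDef_of_le_quadratic (hf.hessian_symm (x k (Fin.last q))) hm hG
    have hl : ∀ i, lam k i ≠ 0 := fun i => (hrun.lineSearch k i).1.ne'
    have hd : ∀ i, step f x B lam k i ≠ 0 := fun i => smul_ne_zero (hl i) fun h =>
      direction_ne_zero (hp.posDef k) (hp.gradient_ne_zero k i) (by rw [h]; rfl)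
    have h1 := (update_potential hWp (hf.hessian_symm _) (hp.posDef k) (he0 k)
      (s := step f x B lam k) (J := selected f τ x B lam cand k) fun z hz => by
        have hv := colMatrix_filterSteps_mulVec_ne_zero (J := cand k) hτ₀
          (lt_max_of_lt_right one_pos : 0 < max M 1) (hf.hessian_symm _)
          (hf.hessian_nonneg _) (hf.hessian_quadratic_le (hp.level k (Fin.last q))) hd hz
        exact ⟨(posDef_iff_real.1 hGp).2 _ hv, hf.gain_hessian_le hm hW hL he2 hv⟩).2 i hi
      (lam k i)⁻¹ (inv_ne_zero (hl i))
    rw [step, smul_smul, inv_mul_cancel₀ (hl i), one_smul] at h1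
    rw [hrun.update_eq k hs]
    exact h1
  obtain ⟨l, hl⟩ := exists_le_potential hWp
  have ht := tendsto_sub_succ_of_summable (a := fun k => potential (hessian f xs) (B k))
    (e := fun k => n * e k) (fun k => hl _ (hp.posDef k)) (hesum.mul_left _) (by
      filter_upwards [hpot, hne] with k hk hs
      obtain ⟨i, hi⟩ := List.exists_mem_of_ne_nil _ hs
      have h1 := hk i hi
      have h2 := gain_nonneg hWp (hp.posDef k)
        (direction_ne_zero (hp.posDef k) (hp.gradient_ne_zero k i))
      linarith)
  filter_upwards [hpot, ht.eventually_lt_const hδ] with k hk hlt i hi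
  have := hk i hi
  linarith

/-- The unit step is eventually admissible for every retained step. -/
lemma Progress.eventually_stepAdmissible {c C : ℝ} (hp : Progress f τ x B lam cand c C)
    (hrun : IsRun f τ x B lam cand α β) (hf : Objective f (x 0 0) xs M μ) (hq : 0 < q)
    (hα : α < 1 / 2) (hβ : 0 < β) (hτ₀ : 0 < τ) (hτ : τ ≤ m) (hS : S ∈ 𝓝 xs)
    (hmS : ∀ y ∈ S, (hessian f y - m • (1 : Matrix (Fin n) (Fin n) ℝ)).PosSemidef) :
    ∀ᶠ k in atTop, ∀ i ∈ selected f τ x B lam cand k,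
      StepAdmissible f α β (x k i.castSucc) (direction f x B k i) 1 := by
  have hm : 0 < m := hτ₀.trans_le hτ
  obtain ⟨r, hr0, hr⟩ := hf.exists_radius hS hmS
  have hr1 := fun y hy => (hr y hy).1
  have hW := hr1 xs (by simpa using hr0.le)
  have hWp := posDef_of_le_quadratic (hf.hessian_symm xs) hm hW
  obtain ⟨ε, hε, hadm⟩ := exists_stepAdmissible_one hf.differentiable hf.twice_differentiable
    hf.gradient_eq_zero hf.continuousAt_hessian hm
    (fun v => by rw [← hessian_quadratic, norm_sq_eq_dotProduct]; exact hW v.ofLp) hα hβ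
  obtain ⟨K, hK, hKW⟩ := exists_bound_mulVec (hessian f xs)
  -- with this gain, the relative error of the Newton equation is at most `ε`
  set δ := min 1 (ε ^ 2 / (13 * K ^ 2)) with hδ
  have hδ0 : 0 < δ := by positivity
  filter_upwards [hp.eventually_near hf hq hm hr0 hr1 hε,
    hp.eventually_gain_lt hrun hf hq hτ₀ hτ hr0 hr hδ0] with k hk hgain i hi
  refine hadm _ _ (hk _) ?_
  set d := direction f x B k i with hd
  have hd0 := direction_ne_zero (hp.posDef k) (hp.gradient_ne_zero k i)
  have h1 := sub_inv_quadratic_le_of_gain_le hWp (hp.posDef k) hd0 (min_le_left _ _)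
    (hgain i hi).le
  rw [mulVec_direction (hp.posDef k), ← hd, hessian_mulVec] at h1
  have h2 : -(gradient f (x k i.castSucc)).ofLp - (fderiv ℝ (gradient f) xs d).ofLp
      = (-(gradient f (x k i.castSucc) + fderiv ℝ (gradient f) xs d)).ofLp := by
    simp only [WithLp.ofLp_neg, WithLp.ofLp_add]; abel
  rw [h2] at h1
  have h3 := dotProduct_self_le_inv hWp (fun v => (hKW v).1)
    (-(gradient f (x k i.castSucc) + fderiv ℝ (gradient f) xs d)).ofLp
  rw [← norm_sq_eq_dotProduct, norm_neg] at h3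
  have h4 := (hKW d.ofLp).1
  rw [← norm_sq_eq_dotProduct, hessian_mulVec] at h4
  have h5 : 13 * δ * K ^ 2 ≤ ε ^ 2 := by
    have := min_le_right 1 (ε ^ 2 / (13 * K ^ 2))
    rw [← hδ, le_div_iff₀ (by positivity)] at this
    linarith
  refine (sq_le_sq₀ (norm_nonneg _) (by positivity)).1 ?_
  rw [mul_pow]
  calc _ ≤ K * (13 * δ * (K * ‖d‖ ^ 2)) :=
        h3.trans (mul_le_mul_of_nonneg_left
          (h1.trans (mul_le_mul_of_nonneg_left h4 (by positivity))) hK.le)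
    _ = 13 * δ * K ^ 2 * ‖d‖ ^ 2 := by ring
    _ ≤ _ := mul_le_mul_of_nonneg_right h5 (sq_nonneg _)

end Eventual

end BlockBFGS

theorem mainTheorem7 {n q : ℕ} (f : EuclideanSpace ℝ (Fin n) → ℝ)
    (α β τ m M : ℝ) (μ : ℝ≥0)
    (hα₀ : 0 < α) (hα : α < 1 / 2) (hαβ : α < β) (hβ : β < 1)
    (xstar : EuclideanSpace ℝ (Fin n))
    (x : ℕ → Fin (q + 1) → EuclideanSpace ℝ (Fin n))
    (B : ℕ → Matrix (Fin n) (Fin n) ℝ)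
    (lam : ℕ → Fin q → ℝ) (cand : ℕ → List (Fin q))
    -- the assumptions on the objective
    (hf : BlockBFGS.Objective f (x 0 0) xstar M μ)
    -- the filtering parameter is at most a lower bound of the Hessian near the minimizer
    (S : Set (EuclideanSpace ℝ (Fin n))) (hS : S ∈ 𝓝 xstar)
    (hm : ∀ y ∈ S, (BlockBFGS.hessian f y - m • (1 : Matrix (Fin n) (Fin n) ℝ)).PosSemidef)
    (hτ₀ : 0 < τ) (hτ : τ ≤ m)
    -- the iterates are produced by Block BFGS
    (hrun : BlockBFGS.IsRun f τ x B lam cand α β)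
    -- the matrix of selected steps contains a step for which the unit step size is not
    -- admissible, whenever the block contains such a step
    (hsel : ∀ᶠ k in atTop,
      (∃ i : Fin q, ¬ BlockBFGS.StepAdmissible f α β (x k i.castSucc)
        (BlockBFGS.direction f x B k i) 1) →
      ∃ i ∈ BlockBFGS.selected f τ x B lam cand k,
        ¬ BlockBFGS.StepAdmissible f α β (x k i.castSucc)
          (BlockBFGS.direction f x B k i) 1) :
    ∀ᶠ k in atTop, ∀ i : Fin q,
      BlockBFGS.StepAdmissible f α β (x k i.castSucc)
        (BlockBFGS.direction f x B k i) 1 := by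
  rcases Nat.eq_zero_or_pos q with rfl | hq
  · exact Eventually.of_forall fun k i => i.elim0
  by_cases hg : ∀ k (i : Fin q), gradient f (x k i.castSucc) ≠ 0
  · obtain ⟨c, C, hp⟩ := hrun.exists_progress hf hα₀ hβ hτ₀ hg
    filter_upwards [hsel, hp.eventually_stepAdmissible hrun hf hq hα (hα₀.trans hαβ) hτ₀ hτ hS hm]
      with k hk hadm i
    by_contra hi
    obtain ⟨j, hj, hj'⟩ := hk ⟨i, hi⟩
    exact hj' (hadm j hj)
  · -- the iteration has reached the minimizer and stays there
    push Not at hg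
    obtain ⟨k₀, i₀, h⟩ := hg
    filter_upwards [eventually_gt_atTop k₀] with k hk i
    exact BlockBFGS.stepAdmissible_of_gradient_eq_zero
      (hrun.gradient_eq_zero_of_lt h k hk i.castSucc)
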